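/- Let $k\ge 3$ be an integer. There is a constant $\tau_0=\tau_0(k)>0$ such that the following holds for every $\tau\in(0,\tau_0]$ with $\tau<1/k$, every admissible function system $(f_n)_{n\ge1}$ with parameter $\tau$ (defined below), and every Borel probability measure $\mu$ on $[0,1]^k$ with $|\hat\mu(\xi)|\le C(1+|\xi|)^{-2}$ for some constant $C$ and all $\xi\in\mathbb R^k$, where $\hat\mu(\xi)=\int e^{-2\pi i\langle\xi,x\rangle}\,d\mu(x)$. Write $\lambda$ for Lebesgue measure on $[0,1]^k$ and, for $\nu\in\{\mu,\lambda\}$, put $\nu(f)=\int_{[0,1]^k}f\,d\nu$ and $$E_N(\nu)=\sum_{n\le N}\nu(f_n),\qquad V_N(\nu)=\int\Big(\sum_{n\le N}\big(f_n(x)-\lambda(f_n)\big)\Big)^2d\nu(x).$$ Then there is a strictly increasing sequence of integers $N\to\infty$ along which $$V_N(\mu)=V_N(\lambda)+o(E_N(\mu)^2)+O(1).$$ Definitions. For $m\ge1$ let $D_m=[2^{m-1},2^m)\cap\mathbb N$, and write $\|t\|$ for the distance from $t\in\mathbb R$ to the nearest integer. An admissible set system with parameter $\tau\in(0,1/k)$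 consists of a shift $y\in\mathbb R^k$, finite (possibly empty) index sets $I_m$ $(m\ge1)$, and, for each $i\in I_m$ and $1\le j\le k$, a real number $d_{i,j}=d_{i,j,m}>0$ and a choice of one of the two interval types $[0,r)$, $[r/2,r)$, with the following properties. (i) $d_{i,j,m}\le 1/(2n)$ for all $n\in D_m$, and there are constants $c,C>0$, independent of $m,n,i,j$, such that $c\,n^{-(1+1/k+\tau)}\le d_{i,j,m}\le C\,n^{-(1+1/k-\tau)}$ for all $n\in D_m$. (ii) For each $m$, the product $\prod_{j\le k}d_{i,j,m}$ does not depend on $i\in I_m$. (iii) For each $n\in D_m$, the sets $A_{n,i}=\{x\in[0,1]^k:\|nx_j-y_j\|\in\mathcal U_{i,j}\ \forall j\}$ $(i\in I_m)$ are pairwise disjoint, where $\mathcal U_{i,j}$ is the interval of the chosen type with $r=nd_{i,j,m}$. (iv) For each $n\in D_m$, the $\mathbb Z^k$-periodic extension of $A_n=\bigcup_{i\in I_m}A_{n,i}$ equals $Z+n^{-1}(y+\mathbb Z^k)$ for some $Z\subseteq[-1/2,1/2]^k$ such that $x\in Z$ and $|z_j|\le|x_j|$ for all $j$ imply $z\in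 Z$. An admissible function system with parameter $\tau$ is a sequence $(f_n)_{n\ge1}$ obtained from such data and from two non-zero smooth functions $\omega_1,\omega_2:\mathbb R\to[0,1]$, vanishing outside $\{|t|<1\}$ and $\{1/2\le|t|<1\}$ respectively, by $$f_n(x)=\sum_{i\in I_m}\ \sum_{a\in\mathbb Z^k}\ \prod_{j\le k}b_{i,j}\!\left(\frac{x_j-(a_j+y_j)/n}{d_{i,j,m}}\right)\qquad(n\in D_m,\ x\in\mathbb R^k),$$ where $b_{i,j}=\omega_1$ if the chosen type for $(i,j)$ is $[0,r)$, and $b_{i,j}=\omega_2$ if it is $[r/2,r)$. -/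

import Mathlib

open MeasureTheory Filter Asymptotics
open scoped ContDiff Pointwise

noncomputable section

namespace CurvedVariance

/-- `k`-dimensional Euclidean space. -/
abbrev E (k : ℕ) : Type := EuclideanSpace ℝ (Fin k)

/-- The closed unit cube `[0,1]^k`. -/
def unitCube (k : ℕ) : Set (E k) := {x | ∀ j, 0 ≤ x j ∧ x j ≤ 1}

/-- Lebesgue measure on `[0,1]^k`. -/
def lebesgueCube (k : ℕ) : Measure (E k) := volume.restrict (unitCube k)

/-- The distance from a real number to the nearest integer. -/
def distInt (t : ℝ) : ℝ := |t - round t|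

/-- The dyadic block `D_m = [2^(m-1), 2^m)`, used for `m ≥ 1`. -/
def dyadicBlock (m : ℕ) : Set ℕ := Set.Ico (2 ^ (m - 1)) (2 ^ m)

/-- The interval attached to a scale `r`: `[0, r)`, or the outer half `[r / 2, r)`. -/
def scaleInterval (outer : Bool) (r : ℝ) : Set ℝ :=
  if outer then Set.Ico (r / 2) r else Set.Ico 0 r

/-- The set of `x` in `[0,1]^k` such that for every `j` the distance from `n x_j - y_j` to the
nearest integer lies in the interval attached to the scale `n d_j`. -/
def boxSet {k : ℕ} (n : ℕ) (y : E k) (d : Fin k → ℝ) (outer : Fin k → Bool) : Set (E k) :=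
  {x | x ∈ unitCube k ∧ ∀ j, distInt (n * x j - y j) ∈ scaleInterval (outer j) (n * d j)}

/-- A set `Z ⊆ [-1/2,1/2]^k` is strongly star-shaped if it is closed under decreasing the absolute
values of the coordinates. -/
def StronglyStarShaped {k : ℕ} (Z : Set (E k)) : Prop :=
  (∀ x ∈ Z, ∀ j, |x j| ≤ 1 / 2) ∧
    ∀ x ∈ Z, ∀ z : E k, (∀ j, |z j| ≤ |x j|) → z ∈ Z

/-- The shifted lattice `n⁻¹ (y + ℤ^k)`. -/
def shiftedLattice {k : ℕ} (n : ℕ) (y : E k) : Set (E k) :=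
  {w | ∃ a : Fin k → ℤ, ∀ j, w j = (y j + a j) / n}

/-- Property `P_n(y)`: the set is `Z + n⁻¹ (y + ℤ^k)` for a strongly star-shaped set `Z`. -/
def HasPropertyP {k : ℕ} (n : ℕ) (y : E k) (X : Set (E k)) : Prop :=
  ∃ Z : Set (E k), StronglyStarShaped Z ∧ X = Z + shiftedLattice n y

/-- The `ℤ^k`-periodic extension of a set. -/
def periodicExtension {k : ℕ} (X : Set (E k)) : Set (E k) :=
  {x | ∃ z ∈ X, ∃ a : Fin k → ℤ, ∀ j, x j = z j + a j}

/-- An admissible set system with parameter `τ`: the data (a shift `y`, for each `m ≥ 1` a finite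
index set `I m`, and for `i ∈ I m` scales `d m i j` with a choice of one of the two attached
intervals), together with the conditions on them. For `n` in the block `D_m` the set `A_n` is the
union over `i ∈ I m` of the sets `boxSet n y (d m i) (outer m i)`. As `A_n` is a subset of
`[0,1]^k`, property `P_n(y)` is required of its periodic extension. -/
structure AdmissibleSetSystem (k : ℕ) (τ : ℝ) (ι : Type) where
  y : E k
  I : ℕ → Finset ι
  d : ℕ → ι → Fin k → ℝ
  outer : ℕ → ι → Fin k → Bool
  tau_pos : 0 < τ
  tau_lt : τ < 1 / (k : ℝ)
  d_pos : ∀ m, 1 ≤ m → ∀ i ∈ I m, ∀ j, 0 < d m i j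
  d_le : ∀ m, 1 ≤ m → ∀ i ∈ I m, ∀ j, ∀ n ∈ dyadicBlock m, d m i j ≤ 1 / (2 * (n : ℝ))
  d_upper : ∃ C : ℝ, 0 < C ∧ ∀ m, 1 ≤ m → ∀ i ∈ I m, ∀ j, ∀ n ∈ dyadicBlock m,
    d m i j ≤ C / (n : ℝ) ^ (1 + 1 / (k : ℝ) - τ)
  d_lower : ∃ c : ℝ, 0 < c ∧ ∀ m, 1 ≤ m → ∀ i ∈ I m, ∀ j, ∀ n ∈ dyadicBlock m,
    c / (n : ℝ) ^ (1 + 1 / (k : ℝ) + τ) ≤ d m i j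
  prod_eq : ∀ m, 1 ≤ m → ∀ i ∈ I m, ∀ i' ∈ I m, ∏ j, d m i j = ∏ j, d m i' j
  disjoint : ∀ m, 1 ≤ m → ∀ n ∈ dyadicBlock m,
    (I m : Set ι).PairwiseDisjoint fun i => boxSet n y (d m i) (outer m i)
  propertyP : ∀ m, 1 ≤ m → ∀ n ∈ dyadicBlock m,
    HasPropertyP n y (periodicExtension (⋃ i ∈ I m, boxSet n y (d m i) (outer m i)))

/-- A non-zero smooth function from `ℝ` to `[0,1]` that vanishes outside the bounded set `S`. -/
structure IsBump (w : ℝ → ℝ) (S : Set ℝ) : Prop where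
  smooth : ContDiff ℝ ∞ w
  mem_unit : ∀ t, 0 ≤ w t ∧ w t ≤ 1
  ne_zero : w ≠ 0
  support_subset : Function.support w ⊆ S

/-- The periodic smooth weight `∑_{a ∈ ℤ^k} ∏_j b_j ((x_j - (a_j + y_j) / n) / d_j)`. For `n ≥ 1`,
`d_j > 0` and compactly supported `b_j`, only finitely many terms are non-zero. -/
def periodicWeight {k : ℕ} (n : ℕ) (y : E k) (d : Fin k → ℝ) (b : Fin k → ℝ → ℝ) (x : E k) : ℝ :=
  ∑' a : Fin k → ℤ, ∏ j, b j ((x j - (a j + y j) / n) / d j)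

/-- `f = (f_n)_{n ≥ 1}` is an admissible function system with parameter `τ`: it is obtained from an
admissible set system and two bump functions `w₁`, `w₂` by smoothing each of the boxes, where `w₁`
is used for the intervals `[0, n d)` and `w₂` for the intervals `[n d / 2, n d)`. -/
def IsAdmissibleFunctionSystem (k : ℕ) (τ : ℝ) (f : ℕ → E k → ℝ) : Prop :=
  ∃ (ι : Type) (A : AdmissibleSetSystem k τ ι) (w₁ w₂ : ℝ → ℝ),
    IsBump w₁ {t | |t| < 1} ∧ IsBump w₂ {t | 1 / 2 ≤ |t| ∧ |t| < 1} ∧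
    ∀ m, 1 ≤ m → ∀ n ∈ dyadicBlock m, ∀ x,
      f n x = ∑ i ∈ A.I m,
        periodicWeight n A.y (A.d m i) (fun j => if A.outer m i j then w₂ else w₁) x

/-- The Fourier transform of a measure, `∫ e^{-2 π i ⟨ξ, x⟩} dμ(x)`. -/
def fourierTransform {k : ℕ} (μ : Measure (E k)) (ξ : E k) : ℂ :=
  ∫ x, Complex.exp (-(2 * Real.pi * inner ℝ ξ x : ℝ) * Complex.I) ∂μ

/-- `μ(g) = ∫_{[0,1]^k} g dμ`. -/
def cubeMean {k : ℕ} (μ : Measure (E k)) (g : E k → ℝ) : ℝ :=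
  ∫ x in unitCube k, g x ∂μ

/-- `E_N(μ) = ∑_{n ≤ N} μ(f_n)`. -/
def expectation {k : ℕ} (f : ℕ → E k → ℝ) (μ : Measure (E k)) (N : ℕ) : ℝ :=
  ∑ n ∈ Finset.Icc 1 N, cubeMean μ (f n)

/-- `V_N(μ) = ∫ (∑_{n ≤ N} (f_n - λ(f_n)))² dμ`, where `λ` is Lebesgue measure on `[0,1]^k`. -/
def variance {k : ℕ} (f : ℕ → E k → ℝ) (μ : Measure (E k)) (N : ℕ) : ℝ :=
  ∫ x, (∑ n ∈ Finset.Icc 1 N, (f n x - cubeMean (lebesgueCube k) (f n))) ^ 2 ∂μ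

/-- The variance transference principle: `V_N(μ) = V_N(λ) + o(E_N(μ)²) + O(1)` along a sequence of
`N → ∞`. -/
def VarianceTransference {k : ℕ} (f : ℕ → E k → ℝ) (μ : Measure (E k)) : Prop :=
  ∃ N : ℕ → ℕ, StrictMono N ∧ ∃ g h : ℕ → ℝ,
    (g =o[atTop] fun r => expectation f μ (N r) ^ 2) ∧
    (h =O[atTop] fun _ => (1 : ℝ)) ∧
    ∀ r, variance f μ (N r) = variance f (lebesgueCube k) (N r) + g r + h r

end CurvedVariance

end

noncomputable section

namespace CurvedVariance

/-! The difference `V_N(μ) - V_N(λ)` is in fact bounded uniformly in `N`, so every `N` serves and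
the little-o term can be taken to be zero.

By Poisson summation `f_n(x) = ∑_t c_n(t) e(n ⟨t, x⟩)`, and `c_n(0) = λ(f_n)`. Expanding the square,
a pair `(n, t), (n', t')` with `t, t' ≠ 0` contributes through the frequency `w = n t + n' t'`. If
`w = 0`, both measures give the same; if `w ≠ 0`, Lebesgue measure gives nothing and `μ` gives `O((1
+ |w|)^{-2})`. This is `abs_variance_sub_le`.

For `n` in the block ending at `R = 2^m`, `exists_fourier_expansion` gives coefficients of size
about `R^{-1+kτ}`, essentially supported on `|t| ≤ R^{1/k+τ}`. The saving `R^{-1+kτ}` holds after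
summing over all boxes, because the boxes are disjoint (`AdmissibleSetSystem.sum_prod_le`).

It remains to bound, for blocks ending at `M ≤ N`, the sum of `(1 + |w|)^{-2}` over truncated
quadruples `(n, n', t, t')` by `M N` with a power of `N` saved. Let `S` be about `N^{1/k}`. If `t,
t'` are independent (`sum_independent_le`), two coordinates of `w` determine `n` and `n'`, and the
other coordinates of `t'` are confined to short intervals. The cost is about `M N^{2/k}`, a saving
since `k ≥ 3`. If `t, t'` are parallel (`sum_parallel_le`), both are multiples of one integer vector
`s`, and the cost is about `M S^{k-1}`, up to logarithms. The resulting decay in `N`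
(`exists_block_bound`) makes the sum over pairs of blocks converge. -/

/-! ### Weighted counts of integer quadruples, independent and parallel -/

theorem sum_le_sum_of_injOn {α β : Type*} {s : Finset α} {t : Finset β} (g : α → β)
    (hmaps : ∀ a ∈ s, g a ∈ t) (hinj : Set.InjOn g s) {f : α → ℝ} {h : β → ℝ}
    (hle : ∀ a ∈ s, f a ≤ h (g a)) (hnn : ∀ b ∈ t, 0 ≤ h b) :
    ∑ a ∈ s, f a ≤ ∑ b ∈ t, h b := by
  classical
  calc ∑ a ∈ s, f a ≤ ∑ a ∈ s, h (g a) := Finset.sum_le_sum hle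
    _ = ∑ b ∈ s.image g, h b := (Finset.sum_image hinj).symm
    _ ≤ ∑ b ∈ t, h b := Finset.sum_le_sum_of_subset_of_nonneg
        (Finset.image_subset_iff.2 hmaps) fun b hb _ => hnn b hb

/-- The integer box `[-X, X]^k`. -/
def intBox (k X : ℕ) : Finset (Fin k → ℤ) :=
  Fintype.piFinset fun _ => Finset.Icc (-(X : ℤ)) X

theorem mem_intBox {k X : ℕ} {t : Fin k → ℤ} : t ∈ intBox k X ↔ ∀ j, |t j| ≤ X := by
  simp [intBox, Fintype.mem_piFinset, abs_le]

theorem card_Icc_neg (X : ℕ) : (Finset.Icc (-(X : ℤ)) X).card = 2 * X + 1 := by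
  rw [Int.card_Icc]; omega

theorem card_intBox (k X : ℕ) : (intBox k X).card = (2 * X + 1) ^ k := by
  simp only [intBox, Fintype.card_piFinset, card_Icc_neg, Finset.prod_const, Finset.card_univ,
    Fintype.card_fin]

/-- The symmetric harmonic sum `∑_{|x| ≤ X} 1 / (1 + |x|)`. -/
def harmonicSum (X : ℕ) : ℝ := ∑ x ∈ Finset.Icc (-(X : ℤ)) X, 1 / (1 + |(x : ℝ)|)

theorem harmonicSum_nonneg (X : ℕ) : 0 ≤ harmonicSum X :=
  Finset.sum_nonneg fun _ _ => by positivity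

/-- The frequency `n t + n' t'` of a product of two characters. -/
def pairFreq {k : ℕ} (n n' : ℕ) (t t' : Fin k → ℤ) : Fin k → ℤ :=
  fun j => n * t j + n' * t' j

theorem abs_coord_le_norm {k : ℕ} (w : Fin k → ℤ) (j : Fin k) : |(w j : ℝ)| ≤ ‖w‖ := by
  rw [← Int.norm_eq_abs]; exact norm_le_pi_norm w j

/-- When the `(i, j)` minor of `(t, t')` is non-zero, Cramer's rule recovers `n, n'` from `t`,
`t'_i`, `t'_j`, `w_i`, `w_j`. Every coordinate `t'_l` then lies within `Q` of `-n t_l / n'`, since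
`|w_l| ≤ Y ≤ Q n'`. The weight is split between `w_i` and `w_j`, giving two harmonic sums. -/
theorem sum_independent_le {k : ℕ} (i j : Fin k) (T S Y Q : ℕ)
    (Ω : Finset (ℕ × ℕ × (Fin k → ℤ) × (Fin k → ℤ)))
    (hΩ : ∀ p ∈ Ω, 0 < p.2.1 ∧ Y ≤ Q * p.2.1 ∧ (∀ l, |p.2.2.1 l| ≤ T) ∧ (∀ l, |p.2.2.2 l| ≤ S) ∧
      (∀ l, |pairFreq p.1 p.2.1 p.2.2.1 p.2.2.2 l| ≤ Y) ∧
      p.2.2.1 i * p.2.2.2 j ≠ p.2.2.1 j * p.2.2.2 i) :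
    ∑ p ∈ Ω, 1 / (1 + ‖pairFreq p.1 p.2.1 p.2.2.1 p.2.2.2‖) ^ 2 ≤
      (2 * T + 1) ^ k * (2 * S + 1) ^ 2 * harmonicSum Y ^ 2 * (2 * Q + 3) ^ k := by
  have key := sum_le_sum_of_injOn (s := Ω)
    (t := intBox k T ×ˢ (Finset.Icc (-(S : ℤ)) S ×ˢ (Finset.Icc (-(S : ℤ)) S ×ˢ
      (Finset.Icc (-(Y : ℤ)) Y ×ˢ (Finset.Icc (-(Y : ℤ)) Y ×ˢ intBox k (Q + 1))))))
    (fun p => (p.2.2.1, p.2.2.2 i, p.2.2.2 j, pairFreq p.1 p.2.1 p.2.2.1 p.2.2.2 i,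
      pairFreq p.1 p.2.1 p.2.2.1 p.2.2.2 j,
      -- Integer division: the floor moves `w_l / n'` by less than one, hence the box of side `Q +
      -- 1`.
      fun l => p.2.2.2 l + (p.1 * p.2.2.1 l) / (p.2.1 : ℤ)))
    (f := fun p => 1 / (1 + ‖pairFreq p.1 p.2.1 p.2.2.1 p.2.2.2‖) ^ 2)
    (h := fun q => 1 / (1 + |(q.2.2.2.1 : ℝ)|) * (1 / (1 + |(q.2.2.2.2.1 : ℝ)|)))
    ?_ ?_ ?_ ?_
  · refine key.trans (le_of_eq ?_)
    simp only [Finset.sum_product, Finset.sum_const, ← Finset.mul_sum, ← Finset.sum_mul,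
      nsmul_eq_mul, card_intBox, card_Icc_neg]
    simp only [harmonicSum]
    push_cast
    ring
  · rintro ⟨n, n', t, t'⟩ hp
    obtain ⟨h0, hY, hT, hS, hw, -⟩ := hΩ _ hp
    simp only at h0 hY hT hS hw
    simp only [Finset.mem_product, mem_intBox, Finset.mem_Icc, ← abs_le]
    refine ⟨hT, hS i, hS j, hw i, hw j, fun l => ?_⟩
    have h1 := hw l
    unfold pairFreq at h1
    have h0' : (0 : ℤ) < n' := by exact_mod_cast h0
    have hY' : (Y : ℤ) ≤ Q * n' := by exact_mod_cast hY
    have hd := Int.mul_ediv_add_emod ((n : ℤ) * t l) n'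
    have hm := Int.emod_nonneg ((n : ℤ) * t l) h0'.ne'
    have hm' := Int.emod_lt_of_pos ((n : ℤ) * t l) h0'
    rw [abs_le] at h1 ⊢
    push_cast
    constructor
    · by_contra hc
      push Not at hc
      have : (t' l + n * t l / n') * n' ≤ (-(Q + 1 : ℤ) - 1) * n' :=
        mul_le_mul_of_nonneg_right (by linarith) h0'.le
      nlinarith
    · by_contra hc
      push Not at hc
      have : ((Q + 1 : ℤ) + 1) * n' ≤ (t' l + n * t l / n') * n' :=
        mul_le_mul_of_nonneg_right (by linarith) h0'.le
      nlinarith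
  · rintro ⟨n, n', t, t'⟩ hp ⟨m, m', s, s'⟩ hq heq
    obtain ⟨-, -, -, -, -, hdet⟩ := hΩ _ hp
    simp only [Prod.mk.injEq, pairFreq] at heq hdet
    obtain ⟨rfl, hi, hj, hwi, hwj, hq⟩ := heq
    rw [← hi] at hwi
    rw [← hj] at hwj
    -- Cramer's rule for the two equations `w_i`, `w_j`, which agree for both quadruples.
    have e1 : ((n : ℤ) - m) * (t i * t' j - t j * t' i) = 0 := by
      linear_combination t' j * hwi - t' i * hwj
    have e2 : ((n' : ℤ) - m') * (t i * t' j - t j * t' i) = 0 := by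
      linear_combination t i * hwj - t j * hwi
    have hd : t i * t' j - t j * t' i ≠ 0 := sub_ne_zero.2 hdet
    have e3 : n = m := by
      have := (mul_eq_zero.1 e1).resolve_right hd
      omega
    have e4 : n' = m' := by
      have := (mul_eq_zero.1 e2).resolve_right hd
      omega
    subst e3 e4
    have : t' = s' := by
      funext l
      simpa using congrFun hq l
    rw [this]
  · rintro ⟨n, n', t, t'⟩ hp
    simp only
    have hi := abs_coord_le_norm (pairFreq n n' t t') i
    have hj := abs_coord_le_norm (pairFreq n n' t t') j
    rw [one_div_mul_one_div, pow_two]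
    gcongr
  · rintro q -
    positivity

/-- Take `s = t / gcd(t)`, which is primitive, and a Bezout vector `u` with `⟨s, u⟩ = 1`.
Proportionality then gives `t' = ⟨t', u⟩ s`, with an integer multiplier. -/
theorem exists_common_direction {k : ℕ} {t t' : Fin k → ℤ} (ht : t ≠ 0)
    (h : ∀ i j, t i * t' j = t j * t' i) :
    ∃ (s : Fin k → ℤ) (a a' : ℤ), t = a • s ∧ t' = a' • s := by
  obtain ⟨i₀, hi₀⟩ := Function.ne_iff.1 ht
  have hne : (Finset.univ : Finset (Fin k)).Nonempty := ⟨i₀, Finset.mem_univ _⟩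
  obtain ⟨s, hs, hg⟩ := Finset.extract_gcd t hne
  obtain ⟨u, hu⟩ := Finset.gcd_eq_sum_mul Finset.univ s
  rw [hg] at hu
  have hg0 : Finset.univ.gcd t ≠ 0 := fun h0 => hi₀ (by
    rw [hs i₀ (Finset.mem_univ _), h0, zero_mul]; rfl)
  refine ⟨s, Finset.univ.gcd t, ∑ j, t' j * u j, funext fun j => hs j (Finset.mem_univ _),
    funext fun l => ?_⟩
  have hst : ∀ i j, s i * t' j = s j * t' i := fun i j => by
    have := h i j
    rw [hs i (Finset.mem_univ _), hs j (Finset.mem_univ _), mul_assoc, mul_assoc] at this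
    exact mul_left_cancel₀ hg0 this
  calc t' l = (∑ j, s j * u j) * t' l := by rw [← hu, one_mul]
    _ = ∑ j, (s j * t' l) * u j := by
      rw [Finset.sum_mul]; exact Finset.sum_congr rfl fun j _ => by ring
    _ = ∑ j, (s l * t' j) * u j := Finset.sum_congr rfl fun j _ => by rw [hst]
    _ = ((∑ j, t' j * u j) • s) l := by
      rw [Pi.smul_apply, smul_eq_mul, Finset.sum_mul]
      exact Finset.sum_congr rfl fun j _ => by ring

/-- The weight `1 / (1 + |x|)` in the first three coordinates, and `1` in the others. -/
def firstThreeWeight {k : ℕ} (j : Fin k) (x : ℤ) : ℝ := if (j : ℕ) < 3 then 1 / (1 + |(x : ℝ)|) else 1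

theorem prod_if_lt_three {k : ℕ} (hk : 3 ≤ k) (a b : ℝ) :
    ∏ j : Fin k, (if (j : ℕ) < 3 then a else b) = a ^ 3 * b ^ (k - 3) := by
  obtain ⟨l, rfl⟩ := Nat.exists_eq_add_of_le' hk
  have h : ∀ x : ℕ, ¬ x + 1 + 1 + 1 < 3 := fun x => by omega
  simp [Fin.prod_univ_succ, pow_succ, mul_assoc, h]

theorem sum_firstThreeWeight {k : ℕ} (hk : 3 ≤ k) (S : ℕ) :
    ∑ s ∈ intBox k S, ∏ j, firstThreeWeight j (s j) =
      harmonicSum S ^ 3 * (2 * S + 1) ^ (k - 3) := by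
  rw [intBox, ← Finset.prod_univ_sum, ← prod_if_lt_three hk]
  refine Finset.prod_congr rfl fun j _ => ?_
  unfold firstThreeWeight
  split_ifs
  · rfl
  · rw [Finset.sum_const, card_Icc_neg]; simp

/-- Distributing the decay over three coordinates makes the sum over `s` factor: three coordinates
cost a logarithm each, and only `k - 3` cost a full side length. -/
theorem inv_norm_cube_le {k : ℕ} (hk : 3 ≤ k) (s : Fin k → ℤ) :
    1 / (1 + ‖s‖) ^ 3 ≤ ∏ j, firstThreeWeight j (s j) := by
  have := prod_if_lt_three hk (1 / (1 + ‖s‖)) 1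
  rw [one_pow, mul_one] at this
  rw [← one_div_pow, ← this]
  refine Finset.prod_le_prod (fun j _ => by split_ifs <;> positivity) fun j _ => ?_
  unfold firstThreeWeight
  split_ifs
  · have := abs_coord_le_norm s j
    gcongr
  · rfl

/-- The identity `a a' v σ³ = (aσ)(a'σ)(vσ) ≤ S² (vσ)` trades a factor `S²` for decay in all four
variables; the `64` comes from `1 + x ≤ 2x` used six times. -/
theorem one_div_one_add_sq_le {v a a' σ S : ℝ} (hv : 1 ≤ v) (ha : 1 ≤ a) (ha' : 1 ≤ a')
    (hσ : 1 ≤ σ) (h : a * σ ≤ S) (h' : a' * σ ≤ S) :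
    1 / (1 + v * σ) ^ 2 ≤ 64 * S ^ 2 * (1 / (1 + a) * (1 / (1 + a') * (1 / (1 + v) *
      (1 / (1 + σ) ^ 3)))) := by
  have e : 64 * S ^ 2 * (1 / (1 + a) * (1 / (1 + a') * (1 / (1 + v) * (1 / (1 + σ) ^ 3)))) =
      64 * S ^ 2 / ((1 + a) * (1 + a') * (1 + v) * (1 + σ) ^ 3) := by field_simp
  rw [e, div_le_div_iff₀ (by positivity) (by positivity), one_mul]
  have h1 : (1 + a) ≤ 2 * a := by linarith
  have h2 : (1 + a') ≤ 2 * a' := by linarith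
  have h3 : (1 + v) ≤ 2 * v := by linarith
  have h4 : (1 + σ) ≤ 2 * σ := by linarith
  have h5 : a * σ * (a' * σ) ≤ S * S := mul_le_mul h h' (by positivity) (by nlinarith)
  calc (1 + a) * (1 + a') * (1 + v) * (1 + σ) ^ 3
      ≤ (2 * a) * (2 * a') * (2 * v) * (2 * σ) ^ 3 := by gcongr
    _ = 64 * (a * σ * (a' * σ)) * (v * σ) := by ring
    _ ≤ 64 * (S * S) * (v * σ) := by gcongr
    _ ≤ 64 * (S * S) * (1 + v * σ) ^ 2 := by
      have h0 : 0 ≤ v * σ := by positivity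
      have h6 : v * σ ≤ (1 + v * σ) ^ 2 := by nlinarith [sq_nonneg (v * σ)]
      exact mul_le_mul_of_nonneg_left h6 (mul_nonneg (by norm_num) (mul_self_nonneg S))
    _ = _ := by ring

theorem one_le_norm_of_ne_zero {k : ℕ} {s : Fin k → ℤ} (hs : s ≠ 0) : 1 ≤ ‖s‖ := by
  obtain ⟨i, hi⟩ := Function.ne_iff.1 hs
  refine le_trans ?_ (abs_coord_le_norm s i)
  exact_mod_cast Int.one_le_abs hi

theorem norm_le_of_abs_le {k : ℕ} {s : Fin k → ℤ} {S : ℕ} (h : ∀ l, |s l| ≤ S) : ‖s‖ ≤ S :=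
  (pi_norm_le_iff_of_nonneg (Nat.cast_nonneg S)).2 fun l => by
    rw [Int.norm_eq_abs]; exact_mod_cast h l

/-- Writing `t = a s`, `t' = a' s` and `w = v s` with `v = n a + n' a'`, the data `(n, a, a', v, s)`
determine `n'` because `a' ≠ 0`. Only `n` is summed without decay, so `n'` costs nothing beyond the
harmonic sum over `v`. -/
theorem sum_parallel_le {k : ℕ} (hk : 3 ≤ k) (M S Y : ℕ)
    (Ω : Finset (ℕ × ℕ × (Fin k → ℤ) × (Fin k → ℤ)))
    (hΩ : ∀ p ∈ Ω, p.1 < M ∧ (∀ l, |p.2.2.1 l| ≤ S) ∧ (∀ l, |p.2.2.2 l| ≤ S) ∧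
      (∀ l, |pairFreq p.1 p.2.1 p.2.2.1 p.2.2.2 l| ≤ Y) ∧ p.2.2.1 ≠ 0 ∧ p.2.2.2 ≠ 0 ∧
      pairFreq p.1 p.2.1 p.2.2.1 p.2.2.2 ≠ 0 ∧
      ∀ i j, p.2.2.1 i * p.2.2.2 j = p.2.2.1 j * p.2.2.2 i) :
    ∑ p ∈ Ω, 1 / (1 + ‖pairFreq p.1 p.2.1 p.2.2.1 p.2.2.2‖) ^ 2 ≤
      64 * S ^ 2 * (M * (harmonicSum S ^ 2 * (harmonicSum Y *
        (harmonicSum S ^ 3 * (2 * S + 1) ^ (k - 3))))) := by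
  have hex : ∀ p : ℕ × ℕ × (Fin k → ℤ) × (Fin k → ℤ), ∃ q : ℤ × ℤ × (Fin k → ℤ), p ∈ Ω →
      p.2.2.1 = q.1 • q.2.2 ∧ p.2.2.2 = q.2.1 • q.2.2 := fun p => by
    by_cases hp : p ∈ Ω
    · obtain ⟨-, -, -, -, h0, -, -, h⟩ := hΩ p hp
      obtain ⟨s, a, a', h1, h2⟩ := exists_common_direction h0 h
      exact ⟨(a, a', s), fun _ => ⟨h1, h2⟩⟩
    · exact ⟨0, fun h => absurd h hp⟩
  choose q hq using hex
  have hfreq : ∀ p ∈ Ω, pairFreq p.1 p.2.1 p.2.2.1 p.2.2.2 =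
      ((p.1 : ℤ) * (q p).1 + p.2.1 * (q p).2.1) • (q p).2.2 := fun p hp => by
    obtain ⟨h1, h2⟩ := hq p hp
    funext l
    simp only [pairFreq, h1, h2, Pi.smul_apply, smul_eq_mul]
    ring
  have hne : ∀ p ∈ Ω, (q p).1 ≠ 0 ∧ (q p).2.1 ≠ 0 ∧ (q p).2.2 ≠ 0 ∧
      ((p.1 : ℤ) * (q p).1 + p.2.1 * (q p).2.1) ≠ 0 := fun p hp => by
    obtain ⟨-, -, -, -, h0, h0', hw0, -⟩ := hΩ p hp
    rw [hfreq p hp] at hw0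
    rw [(hq p hp).1] at h0
    rw [(hq p hp).2] at h0'
    exact ⟨(smul_ne_zero_iff.1 h0).1, (smul_ne_zero_iff.1 h0').1, (smul_ne_zero_iff.1 h0).2,
      (smul_ne_zero_iff.1 hw0).1⟩
  have hnorm : ∀ (c : ℤ) (s : Fin k → ℤ) (X : ℕ), s ≠ 0 → (∀ l, |(c • s) l| ≤ X) →
      |(c : ℝ)| * ‖s‖ ≤ X ∧ |c| ≤ X := fun c s X hs h => by
    have h1 : |(c : ℝ)| * ‖s‖ ≤ X := by
      rw [← Int.norm_eq_abs, ← norm_smul]; exact norm_le_of_abs_le h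
    have h2 : |(c : ℝ)| ≤ X :=
      (le_mul_of_one_le_right (abs_nonneg _) (one_le_norm_of_ne_zero hs)).trans h1
    exact ⟨h1, by exact_mod_cast h2⟩
  have hbox : ∀ (c : ℤ) (s : Fin k → ℤ) (X : ℕ), c ≠ 0 → (∀ l, |(c • s) l| ≤ X) →
      s ∈ intBox k X := fun c s X hc h => mem_intBox.2 fun l => by
    refine le_trans ?_ (h l)
    rw [Pi.smul_apply, smul_eq_mul, abs_mul]
    exact le_mul_of_one_le_left (abs_nonneg _) (Int.one_le_abs hc)
  have key := sum_le_sum_of_injOn (s := Ω)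
    (t := Finset.range M ×ˢ (Finset.Icc (-(S : ℤ)) S ×ˢ (Finset.Icc (-(S : ℤ)) S ×ˢ
      (Finset.Icc (-(Y : ℤ)) Y ×ˢ intBox k S))))
    (fun p => (p.1, (q p).1, (q p).2.1, (p.1 : ℤ) * (q p).1 + p.2.1 * (q p).2.1, (q p).2.2))
    (f := fun p => 1 / (1 + ‖pairFreq p.1 p.2.1 p.2.2.1 p.2.2.2‖) ^ 2)
    (h := fun r => 64 * S ^ 2 * (1 / (1 + |(r.2.1 : ℝ)|) * (1 / (1 + |(r.2.2.1 : ℝ)|) *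
      (1 / (1 + |(r.2.2.2.1 : ℝ)|) * ∏ j, firstThreeWeight j (r.2.2.2.2 j)))))
    ?_ ?_ ?_ ?_
  · refine key.trans (le_of_eq ?_)
    simp only [Finset.sum_product, ← Finset.mul_sum, sum_firstThreeWeight hk,
      Finset.sum_const, nsmul_eq_mul, Finset.card_range, ← Finset.sum_mul]
    simp only [harmonicSum]
    ring
  · intro p hp
    obtain ⟨hM, hS, hS', hY, -⟩ := hΩ p hp
    obtain ⟨ha, ha', hs, hv⟩ := hne p hp
    rw [hfreq p hp] at hY
    rw [(hq p hp).1] at hS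
    rw [(hq p hp).2] at hS'
    simp only [Finset.mem_product, Finset.mem_Icc, ← abs_le, Finset.mem_range]
    exact ⟨hM, (hnorm _ _ _ hs hS).2, (hnorm _ _ _ hs hS').2, (hnorm _ _ _ hs hY).2,
      hbox _ _ _ ha hS⟩
  · intro p hp r hr heq
    obtain ⟨-, ha', -, -⟩ := hne p hp
    simp only [Prod.mk.injEq] at heq
    obtain ⟨h1, h2, h3, h4, h5⟩ := heq
    rw [← h1, ← h2, ← h3, add_right_inj] at h4
    have h6 : p.2.1 = r.2.1 := by exact_mod_cast mul_right_cancel₀ ha' h4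
    refine Prod.ext h1 (Prod.ext h6 (Prod.ext ?_ ?_))
    · rw [(hq p hp).1, (hq r hr).1, h2, h5]
    · rw [(hq p hp).2, (hq r hr).2, h3, h5]
  · intro p hp
    obtain ⟨hM, hS, hS', hY, -⟩ := hΩ p hp
    obtain ⟨ha, ha', hs, hv⟩ := hne p hp
    rw [(hq p hp).1] at hS
    rw [(hq p hp).2] at hS'
    have h1 : ∀ {c : ℤ}, c ≠ 0 → 1 ≤ |(c : ℝ)| := fun h => by exact_mod_cast Int.one_le_abs h
    rw [hfreq p hp, norm_smul, Int.norm_eq_abs]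
    refine (one_div_one_add_sq_le (h1 hv) (h1 ha) (h1 ha') (one_le_norm_of_ne_zero hs)
      (hnorm _ _ _ hs hS).1 (hnorm _ _ _ hs hS').1).trans ?_
    simp only
    gcongr
    exact inv_norm_cube_le hk _
  · rintro r -
    have : 0 ≤ ∏ j, firstThreeWeight j (r.2.2.2.2 j) :=
      (by positivity : (0 : ℝ) ≤ 1 / (1 + ‖r.2.2.2.2‖) ^ 3).trans (inv_norm_cube_le hk _)
    positivity

theorem harmonicSum_le (X : ℕ) : harmonicSum X ≤ 1 + 2 * Real.log (X + 1) := by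
  induction X with
  | zero => simp [harmonicSum]
  | succ X ih =>
    have e : Finset.Icc (-((X + 1 : ℕ) : ℤ)) ((X + 1 : ℕ) : ℤ) =
        insert ((X : ℤ) + 1) (insert (-((X : ℤ) + 1)) (Finset.Icc (-(X : ℤ)) X)) := by
      ext x
      simp only [Finset.mem_insert, Finset.mem_Icc]
      push_cast
      omega
    have e1 : |(((X : ℤ) + 1 : ℤ) : ℝ)| = X + 1 := by
      push_cast; exact abs_of_nonneg (by positivity)
    have e2 : |((-((X : ℤ) + 1) : ℤ) : ℝ)| = X + 1 := by
      rw [Int.cast_neg, abs_neg, e1]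
    have hl : 1 / ((X : ℝ) + 2) ≤ Real.log (X + 2) - Real.log (X + 1) := by
      rw [← Real.log_div (by positivity) (by positivity)]
      refine le_trans (le_of_eq ?_) (Real.one_sub_inv_le_log_of_pos (by positivity))
      field_simp
      ring
    unfold harmonicSum at ih ⊢
    rw [e, Finset.sum_insert, Finset.sum_insert, e1, e2]
    · push_cast
      have : (1 : ℝ) + (X + 1) = X + 2 := by ring
      rw [this]
      have : (X : ℝ) + 1 + 1 = X + 2 := by ring
      rw [this]
      linarith
    · simp
    · simp only [Finset.mem_insert, Finset.mem_Icc]; omega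

/-! ### Fourier series of the periodic weights -/

open scoped FourierTransform in
/-- The Fourier transform of the dilate `v ↦ b (v / r)`. -/
def dilateCoeff (b : ℝ → ℝ) (r : ℝ) (t : ℝ) : ℂ := 𝓕 (fun v : ℝ => (b (v / r) : ℂ)) t

theorem hasCompactSupport_ofReal_dilate {b : ℝ → ℝ} (hb : HasCompactSupport b) {r : ℝ}
    (hr : 0 < r) : HasCompactSupport fun v : ℝ => (b (v / r) : ℂ) := by
  have h := hb.comp_homeomorph (Homeomorph.mulRight₀ r⁻¹ (inv_ne_zero hr.ne'))
  have h2 := h.comp_left (g := Complex.ofReal) (by simp)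
  simpa [Function.comp_def, div_eq_mul_inv] using h2

theorem contDiff_ofReal_dilate {b : ℝ → ℝ} (hb : ContDiff ℝ ∞ b) (r : ℝ) :
    ContDiff ℝ ∞ fun v : ℝ => (b (v / r) : ℂ) :=
  Complex.ofRealCLM.contDiff.comp (hb.comp (contDiff_id.div_const r))

theorem dilateCoeff_eq (b : ℝ → ℝ) {r : ℝ} (hr : 0 < r) (t : ℝ) :
    dilateCoeff b r t = r * dilateCoeff b 1 (r * t) := by
  unfold dilateCoeff
  rw [Real.fourier_real_eq, Real.fourier_real_eq]
  have := MeasureTheory.Measure.integral_comp_div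
    (fun v : ℝ => Real.fourierChar (-(v * (r * t))) • (b (v / 1) : ℂ)) r
  rw [abs_of_pos hr] at this
  rw [← Complex.real_smul, ← this]
  refine integral_congr_ae (ae_of_all _ fun v => ?_)
  have e : v / r * (r * t) = v * t := by field_simp
  simp only [e, div_one]

/-- The transform of a smooth compactly supported function is Schwartz; scaling reduces every `r` to
`r = 1`, so the constant is uniform in `r`. -/
theorem exists_dilateCoeff_le {b : ℝ → ℝ} (hb : ContDiff ℝ ∞ b) (hc : HasCompactSupport b)
    (A : ℕ) : ∃ K : ℝ, 0 < K ∧ ∀ r : ℝ, 0 < r → ∀ t : ℝ,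
      ‖dilateCoeff b r t‖ ≤ K * r * (1 / (1 + r * |t|)) ^ A := by
  let φ : SchwartzMap ℝ ℂ :=
    (hasCompactSupport_ofReal_dilate hc one_pos).toSchwartzMap (contDiff_ofReal_dilate hb 1)
  let ψ : SchwartzMap ℝ ℂ := FourierTransform.fourier φ
  have hψ : ∀ η : ℝ, ψ η = dilateCoeff b 1 η := fun η => by
    unfold dilateCoeff
    change (FourierTransform.fourier φ : SchwartzMap ℝ ℂ) η = _
    rw [SchwartzMap.fourier_coe]
    rfl
  obtain ⟨K, hK⟩ : ∃ K : ℝ, ∀ η : ℝ, (1 + ‖η‖) ^ A * ‖ψ η‖ ≤ K :=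
    ⟨_, fun η => by
      have := SchwartzMap.one_add_le_sup_seminorm_apply (𝕜 := ℝ) (m := (A, 0)) le_rfl le_rfl ψ η
      rwa [norm_iteratedFDeriv_zero] at this⟩
  refine ⟨max K 1, by positivity, fun r hr t => ?_⟩
  have h := hK (r * t)
  rw [hψ, Real.norm_eq_abs, abs_mul, abs_of_pos hr] at h
  have hp : 0 < (1 + r * |t|) ^ A := by positivity
  rw [dilateCoeff_eq b hr, norm_mul, Complex.norm_real, Real.norm_eq_abs, abs_of_pos hr, one_div,
    inv_pow, mul_comm _ r, mul_assoc]
  refine mul_le_mul_of_nonneg_left ?_ hr.le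
  rw [← div_eq_mul_inv, le_div_iff₀ hp, mul_comm]
  exact h.trans (le_max_left _ _)

/-- The character `v ↦ e^{2 π i v}`. -/
def expChar (v : ℝ) : ℂ := Complex.exp (2 * Real.pi * v * Complex.I)

theorem norm_expChar (v : ℝ) : ‖expChar v‖ = 1 := by
  rw [expChar, show (2 * Real.pi * v * Complex.I : ℂ) = ((2 * Real.pi * v : ℝ) : ℂ) * Complex.I by
    push_cast; ring, Complex.norm_exp_ofReal_mul_I]

theorem expChar_add (u v : ℝ) : expChar (u + v) = expChar u * expChar v := by
  rw [expChar, expChar, expChar, ← Complex.exp_add]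
  congr 1; push_cast; ring

theorem expChar_zero : expChar 0 = 1 := by simp [expChar]

theorem expChar_sum {ι : Type*} (s : Finset ι) (g : ι → ℝ) :
    expChar (∑ i ∈ s, g i) = ∏ i ∈ s, expChar (g i) := by
  classical
  induction s using Finset.induction_on with
  | empty => simp [expChar_zero]
  | insert i s hi ih => rw [Finset.sum_insert hi, Finset.prod_insert hi, expChar_add, ih]

theorem continuous_expChar : Continuous expChar := by unfold expChar; fun_prop

theorem summable_one_div_one_add_mul_abs {r : ℝ} (hr : 0 < r) {A : ℕ} (hA : 2 ≤ A) :
    Summable fun t : ℤ => (1 / (1 + r * |(t : ℝ)|)) ^ A := by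
  have h2 : Summable fun t : ℤ => (1 / r ^ 2) * (1 / (t : ℝ) ^ 2) :=
    (Real.summable_one_div_int_pow.2 one_lt_two).mul_left _
  refine Summable.of_norm_bounded_eventually h2 ?_
  rw [Filter.eventually_cofinite]
  refine (Set.finite_singleton (0 : ℤ)).subset fun t ht => ?_
  by_contra h0
  refine ht ?_
  have h0 : (t : ℝ) ≠ 0 := by exact_mod_cast h0
  have h1 : 0 < |(t : ℝ)| := abs_pos.2 h0
  rw [Real.norm_of_nonneg (by positivity)]
  calc (1 / (1 + r * |(t : ℝ)|)) ^ A ≤ (1 / (1 + r * |(t : ℝ)|)) ^ 2 :=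
        pow_le_pow_of_le_one (by positivity) (by
          rw [div_le_one (by positivity)]; nlinarith [mul_pos hr h1]) hA
    _ ≤ (1 / (r * |(t : ℝ)|)) ^ 2 := by gcongr; linarith
    _ = (1 / r ^ 2) * (1 / (t : ℝ) ^ 2) := by rw [div_pow, mul_pow, sq_abs]; field_simp

theorem summable_norm_dilateCoeff {b : ℝ → ℝ} (hb : ContDiff ℝ ∞ b) (hc : HasCompactSupport b)
    {r : ℝ} (hr : 0 < r) : Summable fun t : ℤ => ‖dilateCoeff b r t‖ := by
  obtain ⟨K, -, hK⟩ := exists_dilateCoeff_le hb hc 2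
  exact Summable.of_nonneg_of_le (fun _ => norm_nonneg _) (fun t => hK r hr t)
    ((summable_one_div_one_add_mul_abs hr le_rfl).mul_left _)

theorem poisson_dilate {b : ℝ → ℝ} (hb : ContDiff ℝ ∞ b) (hc : HasCompactSupport b)
    {r : ℝ} (hr : 0 < r) (v : ℝ) :
    ∑' a : ℤ, (b ((v - a) / r) : ℂ) = ∑' t : ℤ, dilateCoeff b r t * expChar (t * v) := by
  let φ : SchwartzMap ℝ ℂ :=
    (hasCompactSupport_ofReal_dilate hc hr).toSchwartzMap (contDiff_ofReal_dilate hb r)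
  have h := SchwartzMap.tsum_eq_tsum_fourier φ v
  -- The library form sums over `v + a`, whereas the weight is a sum over `v - a`.
  rw [← (Equiv.neg ℤ).tsum_eq] at h
  refine Eq.trans (tsum_congr fun a => ?_) (h.trans (tsum_congr fun t => ?_))
  · change _ = (b ((v + ((-a : ℤ) : ℝ)) / r) : ℂ)
    push_cast
    rw [sub_eq_add_neg]
  · rw [SchwartzMap.fourier_coe]
    congr 1
    rw [fourier_coe_apply, expChar]
    congr 1
    push_cast
    ring

theorem summable_norm_dilate {b : ℝ → ℝ} (hc : HasCompactSupport b)
    {r : ℝ} (hr : 0 < r) (v : ℝ) : Summable fun a : ℤ => ‖b ((v - a) / r)‖ := by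
  obtain ⟨R, hR⟩ := hc.isCompact.isBounded.subset_closedBall 0
  refine summable_of_hasFiniteSupport
    ((Set.finite_Icc (⌊v - r * R⌋) (⌈v + r * R⌉)).subset fun a ha => ?_)
  have h1 : (v - a) / r ∈ tsupport b := subset_closure fun h => ha (by
    change ‖b ((v - a) / r)‖ = 0
    rw [h, norm_zero])
  have h2 := hR h1
  rw [mem_closedBall_zero_iff, Real.norm_eq_abs, abs_le, le_div_iff₀ hr, div_le_iff₀ hr] at h2
  constructor
  · have : ((⌊v - r * R⌋ : ℤ) : ℝ) ≤ a := (Int.floor_le _).trans (by linarith)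
    exact_mod_cast this
  · have : (a : ℝ) ≤ (⌈v + r * R⌉ : ℤ) := le_trans (by linarith) (Int.le_ceil _)
    exact_mod_cast this

theorem hasSum_pi_prod {𝕜 : Type*} [RCLike 𝕜] {k : ℕ} (F : Fin k → ℤ → 𝕜)
    (hF : ∀ j, Summable fun a => ‖F j a‖) :
    (Summable fun t : Fin k → ℤ => ‖∏ j, F j (t j)‖) ∧
      ∑' t : Fin k → ℤ, ∏ j, F j (t j) = ∏ j, ∑' a, F j a := by
  induction k with
  | zero => exact ⟨.of_finite, by simp⟩
  | succ k ih =>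
    obtain ⟨h1, h2⟩ := ih (fun j => F j.succ) fun j => hF _
    have e : ∀ p : ℤ × (Fin k → ℤ), ∏ j, F j ((Fin.consEquiv fun _ => ℤ) p j) =
        F 0 p.1 * ∏ j : Fin k, F j.succ (p.2 j) := fun p => by
      rw [Fin.prod_univ_succ]; rfl
    constructor
    · rw [← (Fin.consEquiv fun _ => ℤ).summable_iff]
      refine (Summable.mul_norm (hF 0) h1).congr fun p => ?_
      rw [Function.comp_apply, e]
    · rw [← (Fin.consEquiv fun _ => ℤ).tsum_eq, Fin.prod_univ_succ, ← h2,
        tsum_mul_tsum_of_summable_norm (hF 0) h1]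
      exact tsum_congr e

/-- The Fourier coefficients of `periodicWeight`. -/
def weightCoeff {k : ℕ} (n : ℕ) (y : E k) (d : Fin k → ℝ) (b : Fin k → ℝ → ℝ) (t : Fin k → ℤ) : ℂ :=
  ∏ j, (dilateCoeff (b j) (n * d j) (t j) * expChar (-(t j * y j)))

/-- The character `x ↦ e^{2 π i ⟨w, x⟩}` of integer frequency. -/
def torusChar {k : ℕ} (w : Fin k → ℤ) (x : E k) : ℂ := expChar (∑ j, w j * x j)

theorem periodicWeight_eq_tsum {k : ℕ} {n : ℕ} (hn : 0 < n) (y : E k) {d : Fin k → ℝ}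
    (hd : ∀ j, 0 < d j) {b : Fin k → ℝ → ℝ} (hb : ∀ j, ContDiff ℝ ∞ (b j))
    (hc : ∀ j, HasCompactSupport (b j)) (x : E k) :
    (periodicWeight n y d b x : ℂ) =
      ∑' t : Fin k → ℤ, weightCoeff n y d b t * torusChar (fun j => n * t j) x := by
  have hn' : (0 : ℝ) < n := by exact_mod_cast hn
  have hr : ∀ j, 0 < n * d j := fun j => mul_pos hn' (hd j)
  have e1 : periodicWeight n y d b x = ∏ j, ∑' a : ℤ, b j ((n * x j - y j - a) / (n * d j)) := by
    rw [← (hasSum_pi_prod _ fun j => summable_norm_dilate (hc j) (hr j) _).2]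
    refine tsum_congr fun a => Finset.prod_congr rfl fun j _ => ?_
    congr 1
    have := (hd j).ne'
    field_simp
    ring
  have e2 : ∀ t : Fin k → ℤ, weightCoeff n y d b t * torusChar (fun j => n * t j) x =
      ∏ j, (dilateCoeff (b j) (n * d j) (t j) * expChar (t j * (n * x j - y j))) := fun t => by
    rw [weightCoeff, torusChar, expChar_sum, ← Finset.prod_mul_distrib]
    refine Finset.prod_congr rfl fun j _ => ?_
    rw [mul_assoc, ← expChar_add]
    congr 2
    push_cast
    ring
  rw [tsum_congr e2, (hasSum_pi_prod (fun j (a : ℤ) => dilateCoeff (b j) (n * d j) a *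
    expChar (a * (n * x j - y j))) fun j => ?_).2, e1, Complex.ofReal_prod]
  · refine Finset.prod_congr rfl fun j _ => ?_
    rw [Complex.ofReal_tsum, poisson_dilate (hb j) (hc j) (hr j)]
  · simp only [norm_mul, norm_expChar, mul_one]
    exact summable_norm_dilateCoeff (hb j) (hc j) (hr j)

theorem norm_weightCoeff {k : ℕ} (n : ℕ) (y : E k) (d : Fin k → ℝ) (b : Fin k → ℝ → ℝ)
    (t : Fin k → ℤ) : ‖weightCoeff n y d b t‖ = ∏ j, ‖dilateCoeff (b j) (n * d j) (t j)‖ := by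
  simp [weightCoeff, norm_prod, norm_expChar]

theorem summable_norm_weightCoeff {k : ℕ} {n : ℕ} (hn : 0 < n) (y : E k) {d : Fin k → ℝ}
    (hd : ∀ j, 0 < d j) {b : Fin k → ℝ → ℝ} (hb : ∀ j, ContDiff ℝ ∞ (b j))
    (hc : ∀ j, HasCompactSupport (b j)) : Summable fun t => ‖weightCoeff n y d b t‖ := by
  have hn' : (0 : ℝ) < n := by exact_mod_cast hn
  unfold weightCoeff
  refine (hasSum_pi_prod (fun j (a : ℤ) => dilateCoeff (b j) (n * d j) a *
    expChar (-(a * y j))) fun j => ?_).1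
  simp only [norm_mul, norm_expChar, mul_one]
  exact summable_norm_dilateCoeff (hb j) (hc j) (mul_pos hn' (hd j))

/-! ### Total volume of the boxes in a block -/

theorem distInt_sub_intCast {u : ℝ} (h0 : 0 ≤ u) (h1 : u < 1 / 2) (z : ℤ) :
    distInt (u - z) = u := by
  have : round u = 0 := round_eq_zero_iff.2 ⟨by linarith, h1⟩
  rw [distInt, round_sub_intCast, this]
  push_cast
  rw [show u - z - (0 - z) = u by ring, abs_of_nonneg h0]

theorem nonneg_lt_of_mem_scaleInterval {o : Bool} {r u : ℝ} (hr : 0 < r)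
    (hu : u ∈ scaleInterval o r) : 0 ≤ u ∧ u < r := by
  unfold scaleInterval at hu
  split_ifs at hu
  · exact ⟨by linarith [hu.1], hu.2⟩
  · exact hu

/-- The point depends on `u` alone and not on the box. This order of quantifiers lets disjointness
of the sets in the cube pass to the boxes in the variable `u`. -/
theorem exists_mem_boxSet {k : ℕ} {n : ℕ} (hn : 0 < n) (y : E k) (u : Fin k → ℝ) :
    ∃ x : E k, ∀ (d : Fin k → ℝ) (o : Fin k → Bool), (∀ j, 0 < d j) →
      (∀ j, n * d j ≤ 1 / 2) → (∀ j, u j ∈ scaleInterval (o j) (n * d j)) →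
      x ∈ boxSet n y d o := by
  have hn' : (0 : ℝ) < n := by exact_mod_cast hn
  refine ⟨WithLp.toLp 2 fun j => Int.fract ((y j + u j) / n), fun d o hd hle hu =>
    ⟨fun j => ⟨Int.fract_nonneg _, (Int.fract_lt_one _).le⟩, fun j => ?_⟩⟩
  have h := nonneg_lt_of_mem_scaleInterval (mul_pos hn' (hd j)) (hu j)
  have e : (n : ℝ) * (WithLp.toLp 2 fun j => Int.fract ((y j + u j) / n) : E k) j - y j =
      u j - ((n * ⌊(y j + u j) / n⌋ : ℤ) : ℝ) := by
    simp only [Int.fract]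
    push_cast
    field_simp
    ring
  rw [e, distInt_sub_intCast h.1 (h.2.trans_le (hle j))]
  exact hu j

theorem measurableSet_scaleInterval (o : Bool) (r : ℝ) : MeasurableSet (scaleInterval o r) := by
  unfold scaleInterval
  split_ifs <;> exact measurableSet_Ico

theorem half_le_volume_scaleInterval (o : Bool) {r : ℝ} (hr : 0 < r) :
    ENNReal.ofReal (r / 2) ≤ volume (scaleInterval o r) := by
  unfold scaleInterval
  split_ifs <;> rw [Real.volume_Ico] <;> exact ENNReal.ofReal_le_ofReal (by linarith)

/-- The products of scale intervals are pairwise disjoint subsets of `[0, X)^k`, and each has volume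
at least `∏ (n d_j / 2)`. No bound on the number of boxes is needed. -/
theorem AdmissibleSetSystem.sum_prod_le {k : ℕ} {τ : ℝ} {ι : Type} (A : AdmissibleSetSystem k τ ι)
    {m n : ℕ} (hm : 1 ≤ m) (hn : n ∈ dyadicBlock m) {X : ℝ} (hX : 0 ≤ X)
    (hle : ∀ i ∈ A.I m, ∀ j, n * A.d m i j ≤ X) :
    ∑ i ∈ A.I m, ∏ j, (n * A.d m i j) ≤ (2 * X) ^ k := by
  have hn0 : 0 < n := lt_of_lt_of_le (by positivity) hn.1
  have hn' : (0 : ℝ) < n := by exact_mod_cast hn0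
  have hr : ∀ i ∈ A.I m, ∀ j, 0 < n * A.d m i j := fun i hi j =>
    mul_pos hn' (A.d_pos m hm i hi j)
  have hhalf : ∀ i ∈ A.I m, ∀ j, n * A.d m i j ≤ 1 / 2 := fun i hi j => by
    have := A.d_le m hm i hi j n hn
    rw [le_div_iff₀ (by positivity)] at this
    linarith
  let U : ι → Set (Fin k → ℝ) := fun i =>
    Set.pi Set.univ fun j => scaleInterval (A.outer m i j) (n * A.d m i j)
  have hUdisj : (A.I m : Set ι).PairwiseDisjoint U := by
    intro i hi i' hi' hne
    rw [Function.onFun, Set.disjoint_left]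
    intro u hu hu'
    obtain ⟨x, hx⟩ := exists_mem_boxSet hn0 A.y u
    exact Set.disjoint_left.1 (A.disjoint m hm n hn hi hi' hne)
      (hx _ _ (A.d_pos m hm i hi) (hhalf i hi) fun j => hu j trivial)
      (hx _ _ (A.d_pos m hm i' hi') (hhalf i' hi') fun j => hu' j trivial)
  have hUmeas : ∀ i ∈ A.I m, MeasurableSet (U i) := fun i _ =>
    MeasurableSet.univ_pi fun j => measurableSet_scaleInterval _ _
  have h1 : ∑ i ∈ A.I m, volume (U i) ≤ ENNReal.ofReal (X ^ k) := by
    rw [← measure_biUnion_finset hUdisj hUmeas]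
    refine (measure_mono (t := Set.pi Set.univ fun _ : Fin k => Set.Ico 0 X) ?_).trans ?_
    · refine Set.iUnion₂_subset fun i hi u hu j _ => ?_
      have := nonneg_lt_of_mem_scaleInterval (hr i hi j) (hu j trivial)
      exact ⟨this.1, this.2.trans_le (hle i hi j)⟩
    · rw [volume_pi_pi]
      simp [Real.volume_Ico, ENNReal.ofReal_pow hX]
  have h2 : ∀ i ∈ A.I m, ENNReal.ofReal (∏ j, (n * A.d m i j / 2)) ≤ volume (U i) :=
    fun i hi => by
      rw [volume_pi_pi, ENNReal.ofReal_prod_of_nonneg fun j _ => by linarith [hr i hi j]]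
      exact Finset.prod_le_prod' fun j _ => half_le_volume_scaleInterval _ (hr i hi j)
  have h3 : ∑ i ∈ A.I m, ∏ j, (n * A.d m i j / 2) ≤ X ^ k := by
    rw [← ENNReal.ofReal_le_ofReal_iff (by positivity), ENNReal.ofReal_sum_of_nonneg]
    · exact (Finset.sum_le_sum h2).trans h1
    · exact fun i hi => Finset.prod_nonneg fun j _ => by linarith [hr i hi j]
  simp only [Finset.prod_div_distrib, Finset.prod_const, Finset.card_univ, Fintype.card_fin,
    ← Finset.sum_div] at h3
  rwa [div_le_iff₀ (by positivity), ← mul_pow, mul_comm] at h3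

theorem mem_dyadicBlock_size {n : ℕ} (hn : 0 < n) : 1 ≤ n.size ∧ n ∈ dyadicBlock n.size := by
  have h1 : 1 ≤ n.size := Nat.size_pos.2 hn
  exact ⟨h1, Nat.lt_size.1 (by omega), Nat.size_le.1 le_rfl⟩

theorem size_eq_of_mem_dyadicBlock {m n : ℕ} (hm : 1 ≤ m) (hn : n ∈ dyadicBlock m) :
    n.size = m := by
  have h1 := Nat.lt_size.2 hn.1
  have h2 := Nat.size_le.2 hn.2
  omega

theorem IsBump.hasCompactSupport {w : ℝ → ℝ} {S : Set ℝ} (hw : IsBump w S)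
    (hS : ∀ t ∈ S, |t| ≤ 1) : HasCompactSupport w :=
  HasCompactSupport.of_support_subset_isCompact (isCompact_Icc (a := -1) (b := 1))
    fun t ht => abs_le.1 (hS t (hw.support_subset ht))

/-! ### Coefficient bounds for an admissible function system -/

/-- The majorant `∏_j (1 + |t_j| / X)^{-A}` of the Fourier coefficients. -/
def decayWeight {k : ℕ} (X : ℝ) (A : ℕ) (t : Fin k → ℤ) : ℝ :=
  ∏ j, (1 / (1 + |(t j : ℝ)| / X)) ^ A

theorem rpow_le_two_mul {R n : ℝ} {s : ℝ} (hR : 0 < R) (hn : R ≤ 2 * n) (hs : 0 ≤ s) (hs1 : s ≤ 1) :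
    R ^ s ≤ 2 * n ^ s := by
  have hn0 : 0 < n := by linarith
  calc R ^ s ≤ (2 * n) ^ s := Real.rpow_le_rpow hR.le hn hs
    _ = 2 ^ s * n ^ s := Real.mul_rpow (by norm_num) hn0.le
    _ ≤ 2 * n ^ s := by
      have : (2 : ℝ) ^ s ≤ 2 := by
        simpa using Real.rpow_le_rpow_of_exponent_le (x := 2) (by norm_num) hs1
      gcongr

theorem decay_factor_le {r c R t : ℝ} {A : ℕ} (hc : 0 < c) (hc1 : c ≤ 1) (hR : 0 < R)
    (hr : c / R ≤ r) : (1 / (1 + r * |t|)) ^ A ≤ (1 / c) ^ A * (1 / (1 + |t| / R)) ^ A := by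
  have hr0 : 0 < r := lt_of_lt_of_le (by positivity) hr
  rw [← mul_pow, one_div_mul_one_div]
  have : c * (1 + |t| / R) ≤ 1 + r * |t| := by
    have h2 := mul_le_mul_of_nonneg_right hr (abs_nonneg t)
    have : c * (1 + |t| / R) = c + c / R * |t| := by ring
    linarith
  gcongr

/-- Fourier expansion of an admissible function system, with decay of the coefficients. -/
theorem exists_fourier_expansion {k : ℕ} (hk : 0 < k) {τ : ℝ} {f : ℕ → E k → ℝ}
    (hf : IsAdmissibleFunctionSystem k τ f) (A : ℕ) :
    ∃ (K : ℝ) (c : ℕ → (Fin k → ℤ) → ℂ), 0 < K ∧ ∀ m, 1 ≤ m → ∀ n ∈ dyadicBlock m,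
      (Summable fun t => ‖c n t‖) ∧
      (∀ x, (f n x : ℂ) = ∑' t : Fin k → ℤ, c n t * torusChar (fun j => n * t j) x) ∧
      ∀ t, ‖c n t‖ ≤ K * ((2 : ℝ) ^ m) ^ (-1 + k * τ) *
        decayWeight (((2 : ℝ) ^ m) ^ (1 / (k : ℝ) + τ)) A t := by
  obtain ⟨ι, S, w₁, w₂, hw₁, hw₂, hfx⟩ := hf
  have hk' : (0 : ℝ) < k := by exact_mod_cast hk
  have hc₁ := hw₁.hasCompactSupport fun t ht => le_of_lt ht
  have hc₂ := hw₂.hasCompactSupport fun t ht => le_of_lt ht.2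
  let b : ℕ → ι → Fin k → ℝ → ℝ := fun m i j => if S.outer m i j then w₂ else w₁
  have hb : ∀ m i j, ContDiff ℝ ∞ (b m i j) := fun m i j => by
    simp only [b]; split_ifs; exacts [hw₂.smooth, hw₁.smooth]
  have hbc : ∀ m i j, HasCompactSupport (b m i j) := fun m i j => by
    simp only [b]; split_ifs; exacts [hc₂, hc₁]
  obtain ⟨K, hK0, hK⟩ : ∃ K : ℝ, 0 < K ∧ ∀ m i j (r : ℝ), 0 < r → ∀ t : ℝ,
      ‖dilateCoeff (b m i j) r t‖ ≤ K * r * (1 / (1 + r * |t|)) ^ A := by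
    obtain ⟨K₁, h₁, h₁'⟩ := exists_dilateCoeff_le hw₁.smooth hc₁ A
    obtain ⟨K₂, h₂, h₂'⟩ := exists_dilateCoeff_le hw₂.smooth hc₂ A
    refine ⟨max K₁ K₂, lt_max_of_lt_left h₁, fun m i j r hr t => ?_⟩
    simp only [b]
    split_ifs
    · refine (h₂' r hr t).trans ?_
      gcongr; exact le_max_right _ _
    · refine (h₁' r hr t).trans ?_
      gcongr; exact le_max_left _ _
  obtain ⟨C, hC0, hC⟩ := S.d_upper
  obtain ⟨c₀, hc₀, hcl⟩ := S.d_lower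
  -- The cap at `1` is needed to absorb the constant term of `1 + |t| / R` in `decay_factor_le`.
  set c := min c₀ 1 with hcdef
  have hc0 : 0 < c := lt_min hc₀ one_pos
  -- The binary length `n.size` is the index of the dyadic block containing `n`.
  refine ⟨(K * (1 / c) ^ A) ^ k * (2 * (2 * C)) ^ k, fun n t => ∑ i ∈ S.I n.size,
    weightCoeff n S.y (S.d n.size i) (b n.size i) t, by positivity, fun m hm n hn => ?_⟩
  have hn0 : 0 < n := lt_of_lt_of_le (by positivity) hn.1
  have hn' : (0 : ℝ) < n := by exact_mod_cast hn0
  simp only [size_eq_of_mem_dyadicBlock hm hn]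
  have hsum : ∀ i ∈ S.I m, Summable fun t => ‖weightCoeff n S.y (S.d m i) (b m i) t‖ :=
    fun i hi => summable_norm_weightCoeff hn0 S.y (S.d_pos m hm i hi) (hb m i) (hbc m i)
  refine ⟨?_, fun x => ?_, fun t => ?_⟩
  · exact Summable.of_nonneg_of_le (fun _ => norm_nonneg _) (fun t => norm_sum_le _ _)
      (summable_sum hsum)
  · rw [hfx m hm n hn x, Complex.ofReal_sum]
    simp only [Finset.sum_mul]
    rw [Summable.tsum_finsetSum]
    · refine Finset.sum_congr rfl fun i hi => ?_
      exact periodicWeight_eq_tsum hn0 S.y (S.d_pos m hm i hi) (hb m i) (hbc m i) x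
    · intro i hi
      refine Summable.of_norm ((hsum i hi).congr fun t => ?_)
      rw [norm_mul, torusChar, norm_expChar, mul_one]
  · set R : ℝ := (2 : ℝ) ^ m with hR
    have hR0 : 0 < R := by positivity
    have hnR : (n : ℝ) ≤ R := by rw [hR]; exact_mod_cast hn.2.le
    have hRn : R ≤ 2 * n := by
      have h1 : 2 ^ m ≤ 2 * n := by
        have := hn.1
        obtain ⟨l, rfl⟩ := Nat.exists_eq_add_of_le' hm
        rw [pow_succ]
        simp only [Nat.add_sub_cancel] at this
        omega
      rw [hR]; exact_mod_cast h1
    have hτ := S.tau_pos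
    have hτ' := S.tau_lt
    have hk1 : 1 / (k : ℝ) ≤ 1 := by
      rw [div_le_one hk']; exact_mod_cast hk
    have hr : ∀ i ∈ S.I m, ∀ j, 0 < n * S.d m i j := fun i hi j =>
      mul_pos hn' (S.d_pos m hm i hi j)
    have hup : ∀ i ∈ S.I m, ∀ j, n * S.d m i j ≤ 2 * C * R ^ (-(1 / (k : ℝ) - τ)) :=
      fun i hi j => by
        have h1 := mul_le_mul_of_nonneg_left (hC m hm i hi j n hn) hn'.le
        refine h1.trans ?_
        rw [show 1 + 1 / (k : ℝ) - τ = 1 + (1 / (k : ℝ) - τ) by ring, Real.rpow_add hn',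
          Real.rpow_one, Real.rpow_neg hR0.le]
        have h2 := rpow_le_two_mul hR0 hRn (s := 1 / (k : ℝ) - τ) (by linarith) (by linarith)
        rw [show (n : ℝ) * (C / (n * (n : ℝ) ^ (1 / (k : ℝ) - τ))) =
          C / (n : ℝ) ^ (1 / (k : ℝ) - τ) by field_simp, ← div_eq_mul_inv,
          div_le_div_iff₀ (by positivity) (by positivity)]
        nlinarith
    have hlow : ∀ i ∈ S.I m, ∀ j, c / R ^ (1 / (k : ℝ) + τ) ≤ n * S.d m i j :=
      fun i hi j => by
        have h1 := mul_le_mul_of_nonneg_left (hcl m hm i hi j n hn) hn'.le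
        refine le_trans ?_ h1
        rw [show 1 + 1 / (k : ℝ) + τ = 1 + (1 / (k : ℝ) + τ) by ring, Real.rpow_add hn',
          Real.rpow_one, show (n : ℝ) * (c₀ / (n * (n : ℝ) ^ (1 / (k : ℝ) + τ))) =
          c₀ / (n : ℝ) ^ (1 / (k : ℝ) + τ) by field_simp]
        gcongr
        exact min_le_left _ _
    have hprod := S.sum_prod_le hm hn (by positivity) hup
    -- The main saving: the `k`-th power of the side bound `R^{-1/k+τ}` is `R^{-1+kτ}`.
    have hXk : (2 * (2 * C * R ^ (-(1 / (k : ℝ) - τ)))) ^ k =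
        (2 * (2 * C)) ^ k * R ^ (-1 + k * τ) := by
      rw [← mul_assoc, mul_pow _ (R ^ _), ← Real.rpow_natCast (R ^ _), ← Real.rpow_mul hR0.le]
      congr 2
      field_simp
      ring
    rw [hXk] at hprod
    have hterm : ∀ i ∈ S.I m, ‖weightCoeff n S.y (S.d m i) (b m i) t‖ ≤
        (∏ j, (n * S.d m i j)) * ((K * (1 / c) ^ A) ^ k *
          decayWeight (R ^ (1 / (k : ℝ) + τ)) A t) := fun i hi => by
      rw [norm_weightCoeff]
      have : (∏ j, (n * S.d m i j)) * ((K * (1 / c) ^ A) ^ k *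
          decayWeight (R ^ (1 / (k : ℝ) + τ)) A t) = ∏ j, ((n * S.d m i j) * ((K * (1 / c) ^ A) *
          (1 / (1 + |(t j : ℝ)| / R ^ (1 / (k : ℝ) + τ))) ^ A)) := by
        rw [decayWeight, ← Fin.prod_const, ← Finset.prod_mul_distrib, ← Finset.prod_mul_distrib]
      rw [this]
      refine Finset.prod_le_prod (fun _ _ => norm_nonneg _) fun j _ => ?_
      refine (hK m i j _ (hr i hi j) _).trans ?_
      have h1 := decay_factor_le (t := (t j : ℝ)) (A := A) hc0 (min_le_right _ _)
        (by positivity) (hlow i hi j)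
      have h2 := mul_le_mul_of_nonneg_left h1 (mul_pos hK0 (hr i hi j)).le
      refine h2.trans (le_of_eq ?_)
      ring
    have hdw : 0 ≤ decayWeight (R ^ (1 / (k : ℝ) + τ)) A t :=
      Finset.prod_nonneg fun j _ => by positivity
    calc ‖∑ i ∈ S.I m, weightCoeff n S.y (S.d m i) (b m i) t‖
        ≤ ∑ i ∈ S.I m, ‖weightCoeff n S.y (S.d m i) (b m i) t‖ := norm_sum_le _ _
      _ ≤ ∑ i ∈ S.I m, (∏ j, (n * S.d m i j)) * ((K * (1 / c) ^ A) ^ k *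
          decayWeight (R ^ (1 / (k : ℝ) + τ)) A t) := Finset.sum_le_sum hterm
      _ = (∑ i ∈ S.I m, ∏ j, (n * S.d m i j)) * ((K * (1 / c) ^ A) ^ k *
          decayWeight (R ^ (1 / (k : ℝ) + τ)) A t) := by rw [Finset.sum_mul]
      _ ≤ ((2 * (2 * C)) ^ k * R ^ (-1 + k * τ)) * ((K * (1 / c) ^ A) ^ k *
          decayWeight (R ^ (1 / (k : ℝ) + τ)) A t) := by gcongr
      _ = _ := by ring

/-! ### Characters and the comparison of the two variances -/

theorem norm_torusChar {k : ℕ} (w : Fin k → ℤ) (x : E k) : ‖torusChar w x‖ = 1 := norm_expChar _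

theorem continuous_torusChar {k : ℕ} (w : Fin k → ℤ) : Continuous (torusChar w) :=
  continuous_expChar.comp (by fun_prop)

theorem torusChar_zero {k : ℕ} (x : E k) : torusChar 0 x = 1 := by simp [torusChar, expChar_zero]

theorem torusChar_mul_torusChar {k : ℕ} (n n' : ℕ) (t t' : Fin k → ℤ) (x : E k) :
    torusChar (fun j => n * t j) x * torusChar (fun j => n' * t' j) x =
      torusChar (pairFreq n n' t t') x := by
  rw [torusChar, torusChar, torusChar, ← expChar_add, ← Finset.sum_add_distrib]
  congr 1
  refine Finset.sum_congr rfl fun j _ => ?_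
  simp only [pairFreq]
  push_cast
  ring

theorem integral_torusChar {k : ℕ} (ν : Measure (E k)) (w : Fin k → ℤ) :
    ∫ x, torusChar w x ∂ν = fourierTransform ν (WithLp.toLp 2 fun j => -(w j : ℝ)) := by
  refine integral_congr_ae (ae_of_all _ fun x => ?_)
  simp only [torusChar, expChar, PiLp.inner_apply, RCLike.inner_apply, conj_trivial]
  congr 1
  simp only [mul_neg, Finset.sum_neg_distrib]
  push_cast
  rw [neg_neg]
  congr 3
  exact funext fun j => mul_comm _ _

theorem norm_le_norm_toLp {k : ℕ} (w : Fin k → ℤ) :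
    ‖w‖ ≤ ‖(WithLp.toLp 2 fun j => -(w j : ℝ) : E k)‖ := by
  refine (pi_norm_le_iff_of_nonneg (norm_nonneg _)).2 fun j => ?_
  have := PiLp.norm_apply_le (WithLp.toLp 2 fun j => -(w j : ℝ) : E k) j
  rw [Int.norm_eq_abs]
  simpa using this

theorem norm_integral_torusChar_le {k : ℕ} {ν : Measure (E k)} {C : ℝ} (hC : 0 ≤ C)
    (h : ∀ ξ : E k, ‖fourierTransform ν ξ‖ ≤ C * (1 + ‖ξ‖) ^ (-2 : ℝ)) (w : Fin k → ℤ) :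
    ‖∫ x, torusChar w x ∂ν‖ ≤ C * (1 / (1 + ‖w‖) ^ 2) := by
  rw [integral_torusChar]
  refine (h _).trans ?_
  have := norm_le_norm_toLp w
  rw [Real.rpow_neg (by positivity), Real.rpow_two, one_div]
  gcongr

theorem integral_Icc_expChar (w : ℤ) :
    ∫ u in Set.Icc (0 : ℝ) 1, expChar (w * u) = if w = 0 then 1 else 0 := by
  rw [integral_Icc_eq_integral_Ioc, ← intervalIntegral.integral_of_le zero_le_one]
  split_ifs with h
  · simp [h, expChar_zero]
  · have h0 : (2 * Real.pi * w * Complex.I : ℂ) ≠ 0 := by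
      simp [Real.pi_ne_zero, h]
    have e : ∀ u : ℝ, expChar (w * u) = Complex.exp (2 * Real.pi * w * Complex.I * u) :=
      fun u => by rw [expChar]; congr 1; push_cast; ring
    simp only [e]
    rw [integral_exp_mul_complex h0]
    have : Complex.exp (2 * Real.pi * w * Complex.I) = 1 := by
      rw [Complex.exp_eq_one_iff]; exact ⟨w, by ring⟩
    simp [this]

theorem unitCube_eq_preimage (k : ℕ) : unitCube k = (MeasurableEquiv.toLp 2 (Fin k → ℝ)).symm ⁻¹'
    (Set.pi Set.univ fun _ => Set.Icc (0 : ℝ) 1) := by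
  ext x
  simp only [unitCube, Set.mem_preimage, Set.mem_pi, Set.mem_univ, true_imp_iff, Set.mem_Icc]
  rfl

theorem integral_torusChar_lebesgueCube {k : ℕ} (w : Fin k → ℤ) :
    ∫ x, torusChar w x ∂(lebesgueCube k) = if w = 0 then 1 else 0 := by
  have hmp := EuclideanSpace.volume_preserving_symm_measurableEquiv_toLp (Fin k)
  have h1 : ∫ x, torusChar w x ∂(lebesgueCube k) =
      ∫ u in Set.pi Set.univ fun _ : Fin k => Set.Icc (0 : ℝ) 1, ∏ j, expChar (w j * u j) := by
    rw [lebesgueCube, unitCube_eq_preimage, ← hmp.setIntegral_preimage_emb (MeasurableEquiv.measurableEmbedding _)]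
    refine integral_congr_ae (ae_of_all _ fun x => ?_)
    simp only [torusChar, expChar_sum]
    rfl
  rw [h1, volume_pi, Measure.restrict_pi_pi, integral_fintype_prod_eq_prod (𝕜 := ℂ)
    (fun j (u : ℝ) => expChar (w j * u))]
  simp only [integral_Icc_expChar]
  split_ifs with h
  · simp [h]
  · obtain ⟨j, hj⟩ := Function.ne_iff.1 h
    exact Finset.prod_eq_zero (Finset.mem_univ j) (if_neg hj)

/-- A trigonometric series with frequencies in `n ℤ^k`. -/
def trigSeries {k : ℕ} (n : ℕ) (c : (Fin k → ℤ) → ℂ) (x : E k) : ℂ :=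
  ∑' t, c t * torusChar (fun j => n * t j) x

theorem norm_mul_torusChar {k : ℕ} (z : ℂ) (w : Fin k → ℤ) (x : E k) :
    ‖z * torusChar w x‖ = ‖z‖ := by rw [norm_mul, norm_torusChar, mul_one]

theorem continuous_trigSeries {k : ℕ} {n : ℕ} {c : (Fin k → ℤ) → ℂ}
    (hc : Summable fun t => ‖c t‖) : Continuous (trigSeries n c) :=
  continuous_tsum (fun _ => continuous_const.mul (continuous_torusChar _)) hc
    fun _ _ => (norm_mul_torusChar _ _ _).le

theorem norm_trigSeries_le {k : ℕ} {n : ℕ} {c : (Fin k → ℤ) → ℂ}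
    (hc : Summable fun t => ‖c t‖) (x : E k) : ‖trigSeries n c x‖ ≤ ∑' t, ‖c t‖ :=
  tsum_of_norm_bounded hc.hasSum fun _ => (norm_mul_torusChar _ _ _).le

theorem integral_tsum_torusChar {k : ℕ} {α : Type*} [Countable α] (ν : Measure (E k))
    [IsProbabilityMeasure ν] {a : α → ℂ} (ha : Summable fun p => ‖a p‖) (w : α → Fin k → ℤ) :
    ∫ x, ∑' p, a p * torusChar (w p) x ∂ν = ∑' p, a p * ∫ x, torusChar (w p) x ∂ν := by
  rw [← integral_tsum_of_summable_integral_norm]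
  · exact tsum_congr fun p => integral_const_mul _ _
  · intro p
    refine Integrable.of_bound (C := ‖a p‖)
      (continuous_const.mul (continuous_torusChar _)).aestronglyMeasurable
      (ae_of_all _ fun x => (norm_mul_torusChar _ _ _).le)
  · simpa only [norm_mul_torusChar, integral_const, probReal_univ, one_smul] using ha

theorem trigSeries_mul_trigSeries {k : ℕ} {n n' : ℕ} {c c' : (Fin k → ℤ) → ℂ}
    (hc : Summable fun t => ‖c t‖) (hc' : Summable fun t => ‖c' t‖) (x : E k) :
    trigSeries n c x * trigSeries n' c' x =
      ∑' p : (Fin k → ℤ) × (Fin k → ℤ), c p.1 * c' p.2 * torusChar (pairFreq n n' p.1 p.2) x := by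
  rw [trigSeries, trigSeries, tsum_mul_tsum_of_summable_norm]
  · refine tsum_congr fun p => ?_
    rw [← torusChar_mul_torusChar]
    ring
  · simpa only [norm_mul_torusChar] using hc
  · simpa only [norm_mul_torusChar] using hc'

/-- The weight `(1 + |n t + n' t'|)^{-2}`, set to zero when `t`, `t'` or `n t + n' t'` vanishes. -/
def pairWeight {k : ℕ} (n n' : ℕ) (t t' : Fin k → ℤ) : ℝ :=
  if t = 0 ∨ t' = 0 ∨ pairFreq n n' t t' = 0 then 0 else 1 / (1 + ‖pairFreq n n' t t'‖) ^ 2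

theorem pairWeight_nonneg {k : ℕ} (n n' : ℕ) (t t' : Fin k → ℤ) : 0 ≤ pairWeight n n' t t' := by
  unfold pairWeight; split_ifs <;> positivity

theorem pairWeight_le {k : ℕ} (n n' : ℕ) (t t' : Fin k → ℤ) :
    pairWeight n n' t t' ≤ 1 / (1 + ‖pairFreq n n' t t'‖) ^ 2 := by
  unfold pairWeight; split_ifs <;> first | positivity | rfl

theorem pairWeight_le_one {k : ℕ} (n n' : ℕ) (t t' : Fin k → ℤ) : pairWeight n n' t t' ≤ 1 := by
  refine (pairWeight_le n n' t t').trans ?_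
  rw [div_le_one (by positivity)]
  nlinarith [norm_nonneg (pairFreq n n' t t')]

theorem summable_mul_pairWeight {k : ℕ} {n n' : ℕ} {c c' : (Fin k → ℤ) → ℝ}
    (h0 : ∀ t, 0 ≤ c t) (h0' : ∀ t, 0 ≤ c' t) (hc : Summable c) (hc' : Summable c') :
    Summable fun p : (Fin k → ℤ) × (Fin k → ℤ) => c p.1 * c' p.2 * pairWeight n n' p.1 p.2 :=
  Summable.of_nonneg_of_le
    (fun _ => mul_nonneg (mul_nonneg (h0 _) (h0' _)) (pairWeight_nonneg _ _ _ _))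
    (fun _ => mul_le_of_le_one_right (mul_nonneg (h0 _) (h0' _)) (pairWeight_le_one _ _ _ _))
    (hc.mul_of_nonneg hc' h0 h0')

/-- A coefficient family with its constant term removed. -/
def centre {k : ℕ} (c : (Fin k → ℤ) → ℂ) (t : Fin k → ℤ) : ℂ := if t = 0 then 0 else c t

theorem norm_centre_le {k : ℕ} (c : (Fin k → ℤ) → ℂ) (t : Fin k → ℤ) : ‖centre c t‖ ≤ ‖c t‖ := by
  unfold centre; split_ifs <;> simp

theorem summable_norm_centre {k : ℕ} {c : (Fin k → ℤ) → ℂ} (hc : Summable fun t => ‖c t‖) :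
    Summable fun t => ‖centre c t‖ :=
  Summable.of_nonneg_of_le (fun _ => norm_nonneg _) (norm_centre_le c) hc

instance isProbabilityMeasure_lebesgueCube (k : ℕ) : IsProbabilityMeasure (lebesgueCube k) := by
  have hmp := EuclideanSpace.volume_preserving_symm_measurableEquiv_toLp (Fin k)
  constructor
  rw [lebesgueCube, Measure.restrict_apply_univ, unitCube_eq_preimage, hmp.measure_preimage
    (MeasurableSet.univ_pi fun _ => measurableSet_Icc).nullMeasurableSet, volume_pi_pi]
  simp

theorem cubeMean_lebesgueCube {k : ℕ} {n : ℕ} (hn : 0 < n) {g : E k → ℝ}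
    {c : (Fin k → ℤ) → ℂ} (hc : Summable fun t => ‖c t‖) (hg : ∀ x, (g x : ℂ) = trigSeries n c x) :
    (cubeMean (lebesgueCube k) g : ℂ) = c 0 := by
  have e : (lebesgueCube k).restrict (unitCube k) = lebesgueCube k := by
    rw [lebesgueCube, Measure.restrict_restrict_of_subset subset_rfl]
  rw [cubeMean, e, ← integral_complex_ofReal]
  simp only [hg, trigSeries]
  rw [integral_tsum_torusChar _ hc, tsum_eq_single 0]
  · rw [integral_torusChar_lebesgueCube, if_pos (by ext; simp), mul_one]
  · intro t ht
    rw [integral_torusChar_lebesgueCube, if_neg, mul_zero]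
    intro h
    refine ht (funext fun j => ?_)
    have := congrFun h j
    simpa [hn.ne'] using this

theorem sub_cubeMean_eq {k : ℕ} {n : ℕ} (hn : 0 < n) {g : E k → ℝ}
    {c : (Fin k → ℤ) → ℂ} (hc : Summable fun t => ‖c t‖) (hg : ∀ x, (g x : ℂ) = trigSeries n c x)
    (x : E k) : ((g x - cubeMean (lebesgueCube k) g : ℝ) : ℂ) = trigSeries n (centre c) x := by
  have hs : Summable fun t => c t * torusChar (fun j => n * t j) x :=
    Summable.of_norm (by simpa only [norm_mul_torusChar] using hc)
  rw [Complex.ofReal_sub, cubeMean_lebesgueCube hn hc hg, hg, trigSeries, hs.tsum_eq_add_tsum_ite 0,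
    trigSeries]
  have h0 : torusChar (fun j => n * (0 : Fin k → ℤ) j) x = 1 := by
    rw [← torusChar_zero x]; congr 1
  rw [h0, mul_one, add_sub_cancel_left]
  refine tsum_congr fun t => ?_
  unfold centre
  split_ifs <;> simp

/-- The centring uses `λ(f_n)` for every `ν`, so the same coefficients occur for `μ` and `λ`, and
only the integrals of the characters differ. -/
theorem variance_eq {k : ℕ} {f : ℕ → E k → ℝ} {c : ℕ → (Fin k → ℤ) → ℂ}
    (hc : ∀ n, 0 < n → Summable fun t => ‖c n t‖)
    (hf : ∀ n, 0 < n → ∀ x, (f n x : ℂ) = trigSeries n (c n) x) (ν : Measure (E k))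
    [IsProbabilityMeasure ν] (N : ℕ) :
    (variance f ν N : ℂ) = ∑ n ∈ Finset.Icc 1 N, ∑ n' ∈ Finset.Icc 1 N,
      ∑' p : (Fin k → ℤ) × (Fin k → ℤ), centre (c n) p.1 * centre (c n') p.2 *
        ∫ x, torusChar (pairFreq n n' p.1 p.2) x ∂ν := by
  have hpos : ∀ n ∈ Finset.Icc 1 N, 0 < n := fun n hn => (Finset.mem_Icc.1 hn).1
  have hcc : ∀ n ∈ Finset.Icc 1 N, Summable fun t => ‖centre (c n) t‖ := fun n hn =>
    summable_norm_centre (hc n (hpos n hn))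
  have e : ∀ x, (((∑ n ∈ Finset.Icc 1 N, (f n x - cubeMean (lebesgueCube k) (f n))) ^ 2 : ℝ) : ℂ) =
      ∑ n ∈ Finset.Icc 1 N, ∑ n' ∈ Finset.Icc 1 N,
        trigSeries n (centre (c n)) x * trigSeries n' (centre (c n')) x := fun x => by
    rw [pow_two, Finset.sum_mul_sum]
    push_cast
    refine Finset.sum_congr rfl fun n hn => Finset.sum_congr rfl fun n' hn' => ?_
    rw [← sub_cubeMean_eq (hpos n hn) (hc n (hpos n hn)) (hf n (hpos n hn)),
      ← sub_cubeMean_eq (hpos n' hn') (hc n' (hpos n' hn')) (hf n' (hpos n' hn'))]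
    push_cast
    rfl
  have hint : ∀ n ∈ Finset.Icc 1 N, ∀ n' ∈ Finset.Icc 1 N, Integrable (fun x =>
      trigSeries n (centre (c n)) x * trigSeries n' (centre (c n')) x) ν := fun n hn n' hn' => by
    refine Integrable.of_bound (C := (∑' t, ‖centre (c n) t‖) * ∑' t, ‖centre (c n') t‖)
      ((continuous_trigSeries (hcc n hn)).mul
        (continuous_trigSeries (hcc n' hn'))).aestronglyMeasurable (ae_of_all _ fun x => ?_)
    rw [norm_mul]
    exact mul_le_mul (norm_trigSeries_le (hcc n hn) x) (norm_trigSeries_le (hcc n' hn') x)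
      (norm_nonneg _) (tsum_nonneg fun _ => norm_nonneg _)
  rw [variance, ← integral_complex_ofReal]
  simp only [e]
  rw [integral_finsetSum _ fun n hn => integrable_finsetSum _ (hint n hn)]
  refine Finset.sum_congr rfl fun n hn => ?_
  rw [integral_finsetSum _ (hint n hn)]
  refine Finset.sum_congr rfl fun n' hn' => ?_
  simp only [trigSeries_mul_trigSeries (hcc n hn) (hcc n' hn')]
  refine integral_tsum_torusChar ν ?_ _
  exact (Summable.mul_norm (hcc n hn) (hcc n' hn'))

/-- The difference of the two variances is bounded by the off-diagonal correlations. -/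
theorem abs_variance_sub_le {k : ℕ} {f : ℕ → E k → ℝ} {c : ℕ → (Fin k → ℤ) → ℂ}
    (hc : ∀ n, 0 < n → Summable fun t => ‖c n t‖)
    (hf : ∀ n, 0 < n → ∀ x, (f n x : ℂ) = trigSeries n (c n) x) (μ : Measure (E k))
    [IsProbabilityMeasure μ] {C : ℝ}
    (hμ : ∀ ξ : E k, ‖fourierTransform μ ξ‖ ≤ C * (1 + ‖ξ‖) ^ (-2 : ℝ)) (N : ℕ) :
    |variance f μ N - variance f (lebesgueCube k) N| ≤
      C * ∑ n ∈ Finset.Icc 1 N, ∑ n' ∈ Finset.Icc 1 N,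
        ∑' p : (Fin k → ℤ) × (Fin k → ℤ), ‖c n p.1‖ * ‖c n' p.2‖ * pairWeight n n' p.1 p.2 := by
  have hC : 0 ≤ C := by
    have := (norm_nonneg _).trans (hμ 0)
    simpa using this
  have hpos : ∀ n ∈ Finset.Icc 1 N, 0 < n := fun n hn => (Finset.mem_Icc.1 hn).1
  have hchar : ∀ (ν : Measure (E k)) [IsProbabilityMeasure ν] (w : Fin k → ℤ),
      ‖∫ x, torusChar w x ∂ν‖ ≤ 1 := fun ν _ w => by
    refine (norm_integral_le_of_norm_le_const (C := 1)
      (ae_of_all _ fun x => (norm_torusChar w x).le)).trans ?_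
    simp
  have hs : ∀ (ν : Measure (E k)) [IsProbabilityMeasure ν], ∀ n ∈ Finset.Icc 1 N,
      ∀ n' ∈ Finset.Icc 1 N, Summable fun p : (Fin k → ℤ) × (Fin k → ℤ) =>
        centre (c n) p.1 * centre (c n') p.2 * ∫ x, torusChar (pairFreq n n' p.1 p.2) x ∂ν :=
    fun ν _ n hn n' hn' => by
      refine Summable.of_norm (Summable.of_nonneg_of_le (fun _ => norm_nonneg _) (fun p => ?_)
        (Summable.mul_norm (summable_norm_centre (hc n (hpos n hn)))
          (summable_norm_centre (hc n' (hpos n' hn')))))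
      rw [norm_mul]
      exact mul_le_of_le_one_right (norm_nonneg _) (hchar ν _)
  rw [← Real.norm_eq_abs, ← Complex.norm_real, Complex.ofReal_sub, variance_eq hc hf,
    variance_eq hc hf, ← Finset.sum_sub_distrib, Finset.mul_sum]
  refine norm_sum_le_of_le _ fun n hn => ?_
  rw [← Finset.sum_sub_distrib, Finset.mul_sum]
  refine norm_sum_le_of_le _ fun n' hn' => ?_
  rw [← (hs μ n hn n' hn').tsum_sub (hs (lebesgueCube k) n hn n' hn')]
  refine tsum_of_norm_bounded ((summable_mul_pairWeight (fun t => norm_nonneg (c n t))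
    (fun t => norm_nonneg (c n' t)) (hc n (hpos n hn)) (hc n' (hpos n' hn'))).hasSum.mul_left C)
    fun p => ?_
  rw [← mul_sub, norm_mul, norm_mul, integral_torusChar_lebesgueCube]
  -- Centring kills the first two cases; in the third both probability measures integrate the
  -- trivial character to `1`. Otherwise the Lebesgue integral vanishes and the decay of the
  -- transform of `μ` applies.
  by_cases h0 : p.1 = 0 ∨ p.2 = 0 ∨ pairFreq n n' p.1 p.2 = 0
  · rw [pairWeight, if_pos h0, mul_zero, mul_zero]
    rcases h0 with h | h | h
    · simp [centre, h]
    · simp [centre, h]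
    · simp [h, torusChar_zero]
  · rw [pairWeight, if_neg h0, if_neg fun h => h0 (Or.inr (Or.inr h)), sub_zero, mul_left_comm]
    have h3 := norm_integral_torusChar_le hC hμ (pairFreq n n' p.1 p.2)
    have h4 := norm_centre_le (c n) p.1
    have h5 := norm_centre_le (c n') p.2
    gcongr

/-! ### The counting estimate for a pair of blocks -/

/-- The block `[2^(m-1), 2^m)` as a finite set. -/
def blockFinset (m : ℕ) : Finset ℕ := Finset.Ico (2 ^ (m - 1)) (2 ^ m)

/-- Quadruples `(n, n', t, t')` with bounded entries and bounded non-zero `n t + n' t'`. -/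
def boundedTuples (k m m' T S Y : ℕ) : Finset (ℕ × ℕ × (Fin k → ℤ) × (Fin k → ℤ)) :=
  (blockFinset m ×ˢ (blockFinset m' ×ˢ (intBox k T ×ˢ intBox k S))).filter fun p =>
    p.2.2.1 ≠ 0 ∧ p.2.2.2 ≠ 0 ∧ pairFreq p.1 p.2.1 p.2.2.1 p.2.2.2 ≠ 0 ∧
      ∀ l, |pairFreq p.1 p.2.1 p.2.2.1 p.2.2.2 l| ≤ Y

/-- Either all `2 × 2` minors of `(t, t')` vanish, or one of the `k²` index pairs gives a non-zero
minor; the two terms come from `sum_parallel_le` and `sum_independent_le`. -/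
theorem sum_boundedTuples_le {k : ℕ} (hk : 3 ≤ k) {m m' T S Y Q : ℕ} (hTS : T ≤ S)
    (hQ : Y ≤ Q * 2 ^ (m' - 1)) :
    ∑ p ∈ boundedTuples k m m' T S Y, 1 / (1 + ‖pairFreq p.1 p.2.1 p.2.2.1 p.2.2.2‖) ^ 2 ≤
      64 * S ^ 2 * ((2 ^ m : ℕ) * (harmonicSum S ^ 2 * (harmonicSum Y *
        (harmonicSum S ^ 3 * (2 * S + 1) ^ (k - 3))))) +
      k ^ 2 * ((2 * T + 1) ^ k * (2 * S + 1) ^ 2 * harmonicSum Y ^ 2 * (2 * Q + 3) ^ k) := by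
  classical
  set Ω := boundedTuples k m m' T S Y with hΩdef
  have hΩ : ∀ p ∈ Ω, p.1 < 2 ^ m ∧ 2 ^ (m' - 1) ≤ p.2.1 ∧ (∀ l, |p.2.2.1 l| ≤ T) ∧
      (∀ l, |p.2.2.2 l| ≤ S) ∧ p.2.2.1 ≠ 0 ∧ p.2.2.2 ≠ 0 ∧
      pairFreq p.1 p.2.1 p.2.2.1 p.2.2.2 ≠ 0 ∧
      ∀ l, |pairFreq p.1 p.2.1 p.2.2.1 p.2.2.2 l| ≤ Y := fun p hp => by
    simp only [hΩdef, boundedTuples, Finset.mem_filter, Finset.mem_product, blockFinset,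
      Finset.mem_Ico, mem_intBox] at hp
    exact ⟨hp.1.1.2, hp.1.2.1.1, hp.1.2.2.1, hp.1.2.2.2, hp.2⟩
  let par : ℕ × ℕ × (Fin k → ℤ) × (Fin k → ℤ) → Prop := fun p =>
    ∀ i j, p.2.2.1 i * p.2.2.2 j = p.2.2.1 j * p.2.2.2 i
  let ind : Fin k × Fin k → ℕ × ℕ × (Fin k → ℤ) × (Fin k → ℤ) → Prop := fun q p =>
    p.2.2.1 q.1 * p.2.2.2 q.2 ≠ p.2.2.1 q.2 * p.2.2.2 q.1
  let F : ℕ × ℕ × (Fin k → ℤ) × (Fin k → ℤ) → ℝ := fun p =>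
    1 / (1 + ‖pairFreq p.1 p.2.1 p.2.2.1 p.2.2.2‖) ^ 2
  have hF : ∀ p, 0 ≤ F p := fun p => by positivity
  have hpt : ∀ p ∈ Ω, F p ≤ (if par p then F p else 0) +
      ∑ q : Fin k × Fin k, if ind q p then F p else 0 := fun p _ => by
    by_cases h : par p
    · rw [if_pos h]
      exact le_add_of_nonneg_right (Finset.sum_nonneg fun q _ => by split_ifs <;> simp [hF])
    · obtain ⟨i, hi⟩ := not_forall.1 h
      obtain ⟨j, hj⟩ := not_forall.1 hi
      rw [if_neg h, zero_add]
      refine le_trans (le_of_eq ?_) (Finset.single_le_sum (f := fun q => if ind q p then F p else 0)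
        (fun q _ => by split_ifs <;> simp [hF]) (Finset.mem_univ (i, j)))
      exact (if_pos hj).symm
  refine (Finset.sum_le_sum hpt).trans ?_
  rw [Finset.sum_add_distrib, Finset.sum_comm]
  refine add_le_add ((Finset.sum_filter par F).symm.le.trans ?_) ?_
  · refine sum_parallel_le hk (2 ^ m) S Y _ fun p hp => ?_
    obtain ⟨hp, hpar⟩ := Finset.mem_filter.1 hp
    obtain ⟨h1, -, h3, h4, h5, h6, h7, h8⟩ := hΩ p hp
    exact ⟨h1, fun l => (h3 l).trans (by exact_mod_cast hTS), h4, h8, h5, h6, h7, hpar⟩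
  · refine (Finset.sum_le_card_nsmul _ _ ((2 * T + 1) ^ k * (2 * S + 1) ^ 2 * harmonicSum Y ^ 2 *
      (2 * Q + 3) ^ k) fun q _ => ?_).trans (le_of_eq ?_)
    · refine (Finset.sum_filter (ind q) F).symm.le.trans ?_
      refine sum_independent_le q.1 q.2 T S Y Q _ fun p hp => ?_
      obtain ⟨hp, hind⟩ := Finset.mem_filter.1 hp
      obtain ⟨-, h2, h3, h4, -, -, -, h8⟩ := hΩ p hp
      exact ⟨lt_of_lt_of_le (by positivity) h2, hQ.trans (Nat.mul_le_mul_left _ h2), h3, h4, h8,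
        hind⟩
    · simp [pow_two]

/-- Since `log N = 100 k log L ≤ 100 k L`, each logarithm costs one factor of `L`, the unit in which
all small losses are measured. -/
theorem harmonicSum_le_of_le_sq {k X : ℕ} {L N : ℝ} (hL : 1 ≤ L) (hN : L ^ (100 * k) = N)
    (hX : (X : ℝ) ≤ N ^ 2) : harmonicSum X ≤ (3 + 400 * k) * L := by
  have hN1 : 1 ≤ N := hN ▸ one_le_pow₀ hL
  refine (harmonicSum_le X).trans ?_
  have h1 : Real.log (X + 1) ≤ Real.log (2 * N ^ 2) :=
    Real.log_le_log (by positivity) (by nlinarith)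
  rw [Real.log_mul two_ne_zero (by positivity), Real.log_pow, ← hN, Real.log_pow] at h1
  have h2 : Real.log L ≤ L := (Real.log_le_sub_one_of_pos (by linarith)).trans (by linarith)
  have h3 : Real.log 2 ≤ 1 := (Real.log_le_sub_one_of_pos two_pos).trans (by norm_num)
  have h4 : (k : ℝ) * Real.log L ≤ k * L := by gcongr
  push_cast at h1
  nlinarith

/-- The counting bound for a pair of dyadic blocks. -/
theorem exists_sum_boundedTuples_le {k : ℕ} (hk : 3 ≤ k) : ∃ K : ℝ, 0 < K ∧
    ∀ (m m' : ℕ) (L g X : ℝ), 1 ≤ m' → 1 ≤ L → L ^ (100 * k) = 2 ^ m' → 1 ≤ g → g ^ k ≤ L →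
      1 ≤ X → X ≤ L ^ 100 * g → X ^ k ≤ 2 ^ m * L →
      ∑ p ∈ boundedTuples k m m' ⌊X * g⌋₊ ⌊L ^ 100 * g * g⌋₊ ⌊2 ^ m' * L ^ 15⌋₊,
        1 / (1 + ‖pairFreq p.1 p.2.1 p.2.2.1 p.2.2.2‖) ^ 2 ≤ K * 2 ^ m * 2 ^ m' / L ^ 3 := by
  set c : ℝ := 3 + 400 * k with hc
  refine ⟨64 * 3 ^ k * c ^ 6 + k ^ 2 * (3 ^ k * 9 * c ^ 2 * 9 ^ k), by positivity,
    fun m m' L g X hm' hL hLN hg hgk hX hXL hXk => ?_⟩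
  set M : ℝ := 2 ^ m with hM
  set N : ℝ := 2 ^ m' with hN
  have hN1 : 1 ≤ N := hLN ▸ one_le_pow₀ hL
  have hM1 : 1 ≤ M := one_le_pow₀ (by norm_num)
  have hgL : g ≤ L := (le_self_pow₀ hg (by omega)).trans hgk
  have hLpow : ∀ a, 1 ≤ L ^ a := fun a => one_le_pow₀ hL
  have hSx : 1 ≤ L ^ 100 * g * g :=
    one_le_mul_of_one_le_of_one_le (one_le_mul_of_one_le_of_one_le (hLpow _) hg) hg
  have hTx : 1 ≤ X * g := one_le_mul_of_one_le_of_one_le hX hg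
  set T := ⌊X * g⌋₊
  set S := ⌊L ^ 100 * g * g⌋₊
  set Y := ⌊N * L ^ 15⌋₊
  have hT : (T : ℝ) ≤ X * g := Nat.floor_le (by linarith)
  have hS : (S : ℝ) ≤ L ^ 100 * g * g := Nat.floor_le (by linarith)
  have hY : (Y : ℝ) ≤ N * L ^ 15 := Nat.floor_le (by positivity)
  have hTS : T ≤ S := Nat.floor_le_floor (by gcongr)
  have hLe : ∀ a, a ≤ 100 * k → L ^ a ≤ N := fun a ha => hLN ▸ pow_le_pow_right₀ hL ha
  have hHY : harmonicSum Y ≤ c * L := harmonicSum_le_of_le_sq hL hLN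
    (hY.trans (by rw [pow_two]; gcongr; exact hLe 15 (by omega)))
  have hHS : harmonicSum S ≤ c * L := harmonicSum_le_of_le_sq hL hLN (hS.trans (by
    calc L ^ 100 * g * g ≤ L ^ 100 * L * L := by gcongr
      _ = L ^ 102 := by ring
      _ ≤ N := hLe _ (by omega)
      _ ≤ N ^ 2 := le_self_pow₀ hN1 two_ne_zero))
  -- The factor `2` reflects that `n'` may be as small as `2^(m'-1)`, half of `N`.
  set Q := ⌈2 * L ^ 15⌉₊
  have hQ : (Q : ℝ) ≤ 2 * L ^ 15 + 1 := (Nat.ceil_lt_add_one (by positivity)).le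
  have hQY : Y ≤ Q * 2 ^ (m' - 1) := by
    have h1 : 2 * L ^ 15 ≤ (Q : ℝ) := Nat.le_ceil _
    have h2 : N = 2 * 2 ^ (m' - 1) := by
      rw [hN, ← pow_succ']; congr 1; omega
    have : (Y : ℝ) ≤ Q * 2 ^ (m' - 1) := by
      refine hY.trans ?_
      calc N * L ^ 15 = (2 * L ^ 15) * 2 ^ (m' - 1) := by rw [h2]; ring
        _ ≤ _ := by gcongr
    exact_mod_cast this
  refine (sum_boundedTuples_le hk hTS hQY).trans ?_
  have hT2 : (2 * T + 1 : ℝ) ≤ 3 * (X * g) := by linarith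
  have hS2 : (2 * S + 1 : ℝ) ≤ 3 * (L ^ 100 * g * g) := by linarith
  have hQ2 : (2 * Q + 3 : ℝ) ≤ 9 * L ^ 15 := by linarith [hLpow 15]
  have hS3 : (S : ℝ) ≤ 2 * S + 1 := by linarith [Nat.cast_nonneg (α := ℝ) S]
  have h0S := harmonicSum_nonneg S
  have h0Y := harmonicSum_nonneg Y
  have hpar : 64 * (S : ℝ) ^ 2 * ((2 ^ m : ℕ) * (harmonicSum S ^ 2 * (harmonicSum Y *
        (harmonicSum S ^ 3 * (2 * S + 1) ^ (k - 3))))) ≤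
      64 * 3 ^ k * c ^ 6 * (M * N / L ^ 3) := by
    have hk1 : k - 1 = 2 + (k - 3) := by omega
    have e1 : (2 * S + 1 : ℝ) ^ (k - 1) ≤ 3 ^ k * (L ^ (100 * (k - 1)) * L ^ 2) := by
      calc (2 * S + 1 : ℝ) ^ (k - 1) ≤ (3 * (L ^ 100 * g * g)) ^ (k - 1) := by gcongr
        _ = 3 ^ (k - 1) * (L ^ (100 * (k - 1)) * (g ^ (k - 1)) ^ 2) := by
          rw [mul_pow, mul_pow, mul_pow, pow_mul]; ring
        _ ≤ 3 ^ k * (L ^ (100 * (k - 1)) * L ^ 2) := by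
          have h1 : g ^ (k - 1) ≤ L := (pow_le_pow_right₀ hg (by omega)).trans hgk
          have h2 : (3 : ℝ) ^ (k - 1) ≤ 3 ^ k := pow_le_pow_right₀ (by norm_num) (by omega)
          gcongr
    -- Parallel case: `S^(k-1)` leaves `L^100` to spare, against `L^2` from powers of `g`, `L^6`
    -- from six harmonic sums and the target `L^3`.
    have e2 : L ^ (100 * (k - 1)) * L ^ 2 * L ^ 6 ≤ N / L ^ 3 := by
      rw [le_div_iff₀ (by positivity), ← pow_add, ← pow_add, ← pow_add]
      exact hLe _ (by omega)
    calc 64 * (S : ℝ) ^ 2 * ((2 ^ m : ℕ) * (harmonicSum S ^ 2 * (harmonicSum Y *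
          (harmonicSum S ^ 3 * (2 * S + 1) ^ (k - 3)))))
        ≤ 64 * (2 * S + 1) ^ 2 * (M * ((c * L) ^ 2 * ((c * L) *
          ((c * L) ^ 3 * (2 * S + 1) ^ (k - 3))))) := by
          rw [hM]; push_cast; gcongr
      _ = 64 * c ^ 6 * M * L ^ 6 * (2 * S + 1) ^ (k - 1) := by rw [hk1, pow_add]; ring
      _ ≤ 64 * c ^ 6 * M * L ^ 6 * (3 ^ k * (L ^ (100 * (k - 1)) * L ^ 2)) := by gcongr
      _ = 64 * 3 ^ k * c ^ 6 * M * (L ^ (100 * (k - 1)) * L ^ 2 * L ^ 6) := by ring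
      _ ≤ 64 * 3 ^ k * c ^ 6 * M * (N / L ^ 3) := by gcongr
      _ = _ := by ring
  have hind : (k : ℝ) ^ 2 * ((2 * T + 1) ^ k * (2 * S + 1) ^ 2 * harmonicSum Y ^ 2 *
      (2 * Q + 3) ^ k) ≤ k ^ 2 * (3 ^ k * 9 * c ^ 2 * 9 ^ k) * (M * N / L ^ 3) := by
    -- Here `k ≥ 3` is decisive: `208 + 15 k + 3 ≤ 100 k` fails for `k = 2`. The bulk `L^200` is
    -- `N^(2/k)`, the price of two coordinates of `t'`.
    have e2 : L ^ 208 * L ^ (15 * k) ≤ N / L ^ 3 := by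
      rw [le_div_iff₀ (by positivity), ← pow_add, ← pow_add]
      exact hLe _ (by omega)
    calc (k : ℝ) ^ 2 * ((2 * T + 1) ^ k * (2 * S + 1) ^ 2 * harmonicSum Y ^ 2 * (2 * Q + 3) ^ k)
        ≤ k ^ 2 * ((3 * (X * g)) ^ k * (3 * (L ^ 100 * g * g)) ^ 2 * (c * L) ^ 2 *
          (9 * L ^ 15) ^ k) := by gcongr
      _ = k ^ 2 * (3 ^ k * (X ^ k * g ^ k) * (9 * (L ^ 200 * g ^ 4)) * (c ^ 2 * L ^ 2) *
          (9 ^ k * L ^ (15 * k))) := by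
          rw [mul_pow, mul_pow X, mul_pow 9, pow_mul]; ring
      _ ≤ k ^ 2 * (3 ^ k * ((M * L) * L) * (9 * (L ^ 200 * L ^ 4)) * (c ^ 2 * L ^ 2) *
          (9 ^ k * L ^ (15 * k))) := by gcongr
      _ = k ^ 2 * (3 ^ k * 9 * c ^ 2 * 9 ^ k) * M * (L ^ 208 * L ^ (15 * k)) := by ring
      _ ≤ k ^ 2 * (3 ^ k * 9 * c ^ 2 * 9 ^ k) * M * (N / L ^ 3) := by gcongr
      _ = _ := by ring
  refine (add_le_add hpar hind).trans (le_of_eq ?_)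
  ring

/-! ### Truncation of the Fourier series -/

/-- The subtracted term makes the induction telescope, by `X² / (X+n+1)² ≤ X² / (X+n) - X² /
(X+n+1)`. -/
theorem sum_Icc_inv_sq_le {X : ℝ} (hX : 1 ≤ X) (n : ℕ) :
    ∑ x ∈ Finset.Icc (-(n : ℤ)) n, (1 / (1 + |(x : ℝ)| / X)) ^ 2 ≤
      1 + 2 * X - 2 * X ^ 2 / (X + n) := by
  have h0 : X ≠ 0 := by positivity
  induction n with
  | zero => simp; field_simp; linarith
  | succ n ih =>
    have e : Finset.Icc (-((n + 1 : ℕ) : ℤ)) ((n + 1 : ℕ) : ℤ) =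
        insert ((n : ℤ) + 1) (insert (-((n : ℤ) + 1)) (Finset.Icc (-(n : ℤ)) n)) := by
      ext x
      simp only [Finset.mem_insert, Finset.mem_Icc]
      push_cast
      omega
    have e1 : |(((n : ℤ) + 1 : ℤ) : ℝ)| = n + 1 := by
      push_cast; exact abs_of_nonneg (by positivity)
    have e2 : |((-((n : ℤ) + 1) : ℤ) : ℝ)| = n + 1 := by
      rw [Int.cast_neg, abs_neg, e1]
    have hl : (1 / (1 + ((n : ℝ) + 1) / X)) ^ 2 ≤ X ^ 2 / (X + n) - X ^ 2 / (X + (n + 1)) := by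
      have h1 : (1 / (1 + ((n : ℝ) + 1) / X)) ^ 2 = X ^ 2 / (X + (n + 1)) ^ 2 := by
        rw [← div_pow]; congr 1; field_simp
      rw [h1, div_sub_div _ _ (by positivity) (by positivity),
        div_le_div_iff₀ (by positivity) (by positivity)]
      have h2 : 0 ≤ X ^ 2 * (X + (n + 1)) := by positivity
      nlinarith
    rw [e, Finset.sum_insert, Finset.sum_insert, e1, e2]
    · push_cast
      have h3 : 2 * X ^ 2 / (X + n) = 2 * (X ^ 2 / (X + n)) := by ring
      have h4 : 2 * X ^ 2 / (X + ((n : ℝ) + 1)) = 2 * (X ^ 2 / (X + (n + 1))) := by ring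
      rw [h3] at ih
      rw [h4]
      linarith
    · simp
    · simp only [Finset.mem_insert, Finset.mem_Icc]; omega

theorem tsum_inv_sq_le {X : ℝ} (hX : 1 ≤ X) :
    ∑' x : ℤ, (1 / (1 + |(x : ℝ)| / X)) ^ 2 ≤ 3 * X := by
  refine Real.tsum_le_of_sum_le (fun x => by positivity) fun s => ?_
  obtain ⟨n, hn⟩ : ∃ n : ℕ, s ⊆ Finset.Icc (-(n : ℤ)) n := by
    refine ⟨s.sup Int.natAbs, fun x hx => ?_⟩
    have : x.natAbs ≤ s.sup Int.natAbs := Finset.le_sup (f := Int.natAbs) hx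
    rw [Finset.mem_Icc]
    omega
  refine (Finset.sum_le_sum_of_subset_of_nonneg hn fun _ _ _ => by positivity).trans
    ((sum_Icc_inv_sq_le hX n).trans ?_)
  have : 0 ≤ 2 * X ^ 2 / (X + n) := by positivity
  linarith

theorem summable_inv_pow {X : ℝ} (hX : 0 < X) {A : ℕ} (hA : 2 ≤ A) :
    Summable fun x : ℤ => (1 / (1 + |(x : ℝ)| / X)) ^ A :=
  (summable_one_div_one_add_mul_abs (inv_pos.2 hX) hA).congr fun x => by
    rw [div_eq_inv_mul |(x : ℝ)| X]

theorem summable_decayWeight {k : ℕ} {X : ℝ} (hX : 0 < X) {A : ℕ} (hA : 2 ≤ A) :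
    Summable (decayWeight (k := k) X A) := by
  have := (hasSum_pi_prod (k := k) (fun _ (x : ℤ) => (1 / (1 + |(x : ℝ)| / X)) ^ A) fun _ =>
    (summable_inv_pow hX hA).norm).1
  exact Summable.of_norm this

theorem tsum_decayWeight_two_le {k : ℕ} {X : ℝ} (hX : 1 ≤ X) :
    ∑' t, decayWeight (k := k) X 2 t ≤ 3 ^ k * X ^ k := by
  have h := (hasSum_pi_prod (k := k) (fun _ (x : ℤ) => (1 / (1 + |(x : ℝ)| / X)) ^ 2) fun _ =>
    (summable_inv_pow (by linarith) le_rfl).norm).2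
  unfold decayWeight
  rw [h, Fin.prod_const, ← mul_pow]
  gcongr
  exact tsum_inv_sq_le hX

theorem decayWeight_nonneg {k : ℕ} {X : ℝ} (hX : 0 < X) (A : ℕ) (t : Fin k → ℤ) :
    0 ≤ decayWeight X A t :=
  Finset.prod_nonneg fun _ _ => by positivity

theorem decayWeight_le_one {k : ℕ} {X : ℝ} (hX : 0 < X) (A : ℕ) (t : Fin k → ℤ) :
    decayWeight X A t ≤ 1 :=
  Finset.prod_le_one (fun _ _ => by positivity) fun j _ =>
    pow_le_one₀ (by positivity) (by
      rw [div_le_one (by positivity)]; linarith [div_nonneg (abs_nonneg (t j : ℝ)) hX.le])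

theorem decayWeight_add {k : ℕ} (X : ℝ) (A B : ℕ) (t : Fin k → ℤ) :
    decayWeight X (A + B) t = decayWeight X A t * decayWeight X B t := by
  simp only [decayWeight, pow_add, Finset.prod_mul_distrib]

/-- Outside the box of side `X g` the weight is smaller than any power of `g⁻¹`. -/
theorem decayWeight_le_of_lt {k : ℕ} {X g : ℝ} (hX : 0 < X) (hg : 0 < g) (B : ℕ)
    {t : Fin k → ℤ} {j : Fin k} (h : X * g < |(t j : ℝ)|) : decayWeight X B t ≤ 1 / g ^ B := by
  classical
  rw [decayWeight, ← Finset.mul_prod_erase _ _ (Finset.mem_univ j), ← one_div_pow]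
  have h1 : g < |(t j : ℝ)| / X := by rwa [lt_div_iff₀ hX, mul_comm]
  have h2 : (1 / (1 + |(t j : ℝ)| / X)) ^ B ≤ (1 / g) ^ B := by gcongr; linarith
  refine (mul_le_of_le_one_right (by positivity) ?_).trans h2
  exact Finset.prod_le_one (fun _ _ => by positivity) fun j _ =>
    pow_le_one₀ (by positivity) (by
      rw [div_le_one (by positivity)]; linarith [div_nonneg (abs_nonneg (t j : ℝ)) hX.le])

/-- Of the exponent `2 + B`, the `2` is kept for summability and the `B` is spent on the tail. A
quadruple with non-zero `pairWeight` outside the truncated set has a large coordinate of `t`, `t'`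
or `w`, and each possibility alone gives a factor at most `δ`. -/
theorem decay_mul_pairWeight_le {k m m' n n' B : ℕ} (hn : n ∈ blockFinset m)
    (hn' : n' ∈ blockFinset m') {X X' g D δ : ℝ} (hX : 0 < X) (hX' : 0 < X') (hg : 0 < g)
    (hD : 0 < D) (hB : 1 / g ^ B ≤ δ) (hδ : 1 / D ^ 2 ≤ δ) (t t' : Fin k → ℤ) :
    decayWeight X (2 + B) t * decayWeight X' (2 + B) t' * pairWeight n n' t t' ≤
      δ * (decayWeight X 2 t * decayWeight X' 2 t') +
      if (n, n', t, t') ∈ boundedTuples k m m' ⌊X * g⌋₊ ⌊X' * g⌋₊ ⌊D⌋₊ then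
        1 / (1 + ‖pairFreq n n' t t'‖) ^ 2 else 0 := by
  have w1 := decayWeight_nonneg hX 2 t
  have w2 := decayWeight_nonneg hX' 2 t'
  have b1 := decayWeight_nonneg hX B t
  have b2 := decayWeight_nonneg hX' B t'
  have b3 := decayWeight_le_one hX B t
  have b4 := decayWeight_le_one hX' B t'
  have p1 := pairWeight_nonneg n n' t t'
  have p2 := pairWeight_le_one n n' t t'
  have hδ0 : 0 ≤ δ := le_trans (by positivity) hδ
  rw [decayWeight_add, decayWeight_add]
  split_ifs with h
  · have h1 : decayWeight X 2 t * decayWeight X B t * (decayWeight X' 2 t' * decayWeight X' B t') ≤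
        1 := mul_le_one₀ (mul_le_one₀ (decayWeight_le_one hX 2 t) b1 b3) (by positivity)
          (mul_le_one₀ (decayWeight_le_one hX' 2 t') b2 b4)
    have h2 := pairWeight_le n n' t t'
    have h3 : 0 ≤ δ * (decayWeight X 2 t * decayWeight X' 2 t') := by positivity
    have h4 := mul_le_mul_of_nonneg_right h1 p1
    linarith
  · rw [add_zero]
    have key : decayWeight X B t * decayWeight X' B t' * pairWeight n n' t t' ≤ δ := by
      by_cases hz : t = 0 ∨ t' = 0 ∨ pairFreq n n' t t' = 0
      · rw [pairWeight, if_pos hz, mul_zero]; exact hδ0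
      push Not at hz
      have hnat : ∀ {z : ℤ} {x : ℝ}, 0 ≤ x → |(z : ℝ)| ≤ x → |z| ≤ (⌊x⌋₊ : ℤ) :=
        fun {z x} hx hz => by
          rw [Int.abs_eq_natAbs]
          have : z.natAbs ≤ ⌊x⌋₊ := Nat.le_floor (by rwa [Nat.cast_natAbs, Int.cast_abs])
          exact_mod_cast this
      by_cases c1 : ∃ j, X * g < |(t j : ℝ)|
      · obtain ⟨j, hj⟩ := c1
        calc _ ≤ decayWeight X B t * 1 * 1 := by gcongr
          _ ≤ δ := by rw [mul_one, mul_one]; exact (decayWeight_le_of_lt hX hg B hj).trans hB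
      by_cases c2 : ∃ j, X' * g < |(t' j : ℝ)|
      · obtain ⟨j, hj⟩ := c2
        calc _ ≤ 1 * decayWeight X' B t' * 1 := by gcongr
          _ ≤ δ := by rw [one_mul, mul_one]; exact (decayWeight_le_of_lt hX' hg B hj).trans hB
      by_cases c3 : ∃ j, D < |(pairFreq n n' t t' j : ℝ)|
      · obtain ⟨j, hj⟩ := c3
        calc _ ≤ 1 * 1 * pairWeight n n' t t' := by gcongr
          _ ≤ 1 / (1 + ‖pairFreq n n' t t'‖) ^ 2 := by
            rw [one_mul, one_mul]; exact pairWeight_le _ _ _ _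
          _ ≤ 1 / D ^ 2 := by
            have := abs_coord_le_norm (pairFreq n n' t t') j
            gcongr
            linarith
          _ ≤ δ := hδ
      · push Not at c1 c2 c3
        refine absurd ?_ h
        simp only [boundedTuples, Finset.mem_filter, Finset.mem_product, mem_intBox]
        exact ⟨⟨hn, hn', fun l => hnat (by positivity) (c1 l), fun l => hnat (by positivity) (c2 l)⟩,
          hz.1, hz.2.1, hz.2.2, fun l => hnat hD.le (c3 l)⟩
    calc _ = (decayWeight X 2 t * decayWeight X' 2 t') *
          (decayWeight X B t * decayWeight X' B t' * pairWeight n n' t t') := by ring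
      _ ≤ (decayWeight X 2 t * decayWeight X' 2 t') * δ := by gcongr
      _ = _ := mul_comm _ _

theorem tsum_ite_boundedTuples (k m m' T S Y n n' : ℕ) :
    HasSum (fun p : (Fin k → ℤ) × (Fin k → ℤ) =>
      if (n, n', p.1, p.2) ∈ boundedTuples k m m' T S Y then
        1 / (1 + ‖pairFreq n n' p.1 p.2‖) ^ 2 else 0)
      (∑ p ∈ intBox k T ×ˢ intBox k S, if (n, n', p.1, p.2) ∈ boundedTuples k m m' T S Y then
        1 / (1 + ‖pairFreq n n' p.1 p.2‖) ^ 2 else 0) := by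
  refine hasSum_sum_of_ne_finset_zero fun p hp => if_neg fun h => hp ?_
  simp only [boundedTuples, Finset.mem_filter, Finset.mem_product] at h
  exact Finset.mem_product.2 h.1.2.2

theorem sum_ite_boundedTuples (k m m' T S Y : ℕ) :
    ∑ n ∈ blockFinset m, ∑ n' ∈ blockFinset m', ∑ p ∈ intBox k T ×ˢ intBox k S,
      (if (n, n', p.1, p.2) ∈ boundedTuples k m m' T S Y then
        1 / (1 + ‖pairFreq n n' p.1 p.2‖) ^ 2 else 0) =
      ∑ p ∈ boundedTuples k m m' T S Y,
        1 / (1 + ‖pairFreq p.1 p.2.1 p.2.2.1 p.2.2.2‖) ^ 2 := by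
  simp only [← Finset.sum_product']
  rw [← Finset.sum_filter]
  refine Finset.sum_congr ?_ fun _ _ => rfl
  ext p
  simp only [Finset.mem_filter, and_iff_right_iff_imp]
  exact fun h => (Finset.mem_filter.1 h).1

theorem mem_blockFinset {m n : ℕ} : n ∈ blockFinset m ↔ n ∈ dyadicBlock m := by
  rw [blockFinset, Finset.mem_Ico, dyadicBlock, Set.mem_Ico]

theorem card_blockFinset_le (m : ℕ) : ((blockFinset m).card : ℝ) ≤ 2 ^ m := by
  rw [blockFinset, Nat.card_Ico]
  exact_mod_cast Nat.sub_le _ _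

theorem sum_block_le {k m m' B : ℕ} {X X' g D δ G : ℝ} (hX : 1 ≤ X) (hX' : 1 ≤ X')
    (hg : 0 < g) (hD : 0 < D) (hB : 1 / g ^ B ≤ δ) (hδ : 1 / D ^ 2 ≤ δ)
    (hG : ∑ p ∈ boundedTuples k m m' ⌊X * g⌋₊ ⌊X' * g⌋₊ ⌊D⌋₊,
      1 / (1 + ‖pairFreq p.1 p.2.1 p.2.2.1 p.2.2.2‖) ^ 2 ≤ G) :
    ∑ n ∈ blockFinset m, ∑ n' ∈ blockFinset m', ∑' p : (Fin k → ℤ) × (Fin k → ℤ),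
      decayWeight X (2 + B) p.1 * decayWeight X' (2 + B) p.2 * pairWeight n n' p.1 p.2 ≤
      2 ^ m * 2 ^ m' * (δ * ((3 ^ k * X ^ k) * (3 ^ k * X' ^ k))) + G := by
  have hX0 : 0 < X := by linarith
  have hX0' : 0 < X' := by linarith
  have hδ0 : 0 ≤ δ := le_trans (by positivity) hδ
  have hs := summable_decayWeight (k := k) hX0 le_rfl
  have hs' := summable_decayWeight (k := k) hX0' le_rfl
  set Z := δ * ((3 ^ k * X ^ k) * (3 ^ k * X' ^ k)) with hZ
  have hprod : ∑' p : (Fin k → ℤ) × (Fin k → ℤ), decayWeight X 2 p.1 * decayWeight X' 2 p.2 ≤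
      (3 ^ k * X ^ k) * (3 ^ k * X' ^ k) := by
    rw [← tsum_mul_tsum_of_summable_norm hs.norm hs'.norm]
    exact mul_le_mul (tsum_decayWeight_two_le hX) (tsum_decayWeight_two_le hX')
      (tsum_nonneg fun t => decayWeight_nonneg hX0' 2 t) (by positivity)
  have h1 : ∀ n ∈ blockFinset m, ∀ n' ∈ blockFinset m', ∑' p : (Fin k → ℤ) × (Fin k → ℤ),
      decayWeight X (2 + B) p.1 * decayWeight X' (2 + B) p.2 * pairWeight n n' p.1 p.2 ≤
      Z + ∑ p ∈ intBox k ⌊X * g⌋₊ ×ˢ intBox k ⌊X' * g⌋₊,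
        if (n, n', p.1, p.2) ∈ boundedTuples k m m' ⌊X * g⌋₊ ⌊X' * g⌋₊ ⌊D⌋₊ then
          1 / (1 + ‖pairFreq n n' p.1 p.2‖) ^ 2 else 0 := fun n hn n' hn' => by
    have hs2 : Summable fun p : (Fin k → ℤ) × (Fin k → ℤ) =>
        δ * (decayWeight X 2 p.1 * decayWeight X' 2 p.2) := by
      refine Summable.mul_left δ ?_
      exact hs.mul_of_nonneg hs' (decayWeight_nonneg hX0 2) (decayWeight_nonneg hX0' 2)
    have hs3 := tsum_ite_boundedTuples k m m' ⌊X * g⌋₊ ⌊X' * g⌋₊ ⌊D⌋₊ n n'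
    have hle : ∀ p : (Fin k → ℤ) × (Fin k → ℤ), _ ≤ _ := fun p =>
      decay_mul_pairWeight_le hn hn' hX0 hX0' hg hD hB hδ p.1 p.2
    have hs1 := summable_mul_pairWeight (n := n) (n' := n') (c := decayWeight (k := k) X (2 + B))
      (c' := decayWeight X' (2 + B)) (decayWeight_nonneg hX0 _) (decayWeight_nonneg hX0' _)
      (summable_decayWeight hX0 (by omega)) (summable_decayWeight hX0' (by omega))
    have h2 := hs1.tsum_le_tsum hle (hs2.add hs3.summable)
    rw [hs2.tsum_add hs3.summable, hs3.tsum_eq, tsum_mul_left] at h2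
    exact h2.trans (add_le_add (mul_le_mul_of_nonneg_left hprod hδ0) le_rfl)
  refine (Finset.sum_le_sum fun n hn => Finset.sum_le_sum fun n' hn' => h1 n hn n' hn').trans ?_
  simp only [Finset.sum_add_distrib, Finset.sum_const, nsmul_eq_mul]
  rw [sum_ite_boundedTuples, ← mul_assoc]
  have hZ0 : 0 ≤ Z := by positivity
  have := card_blockFinset_le m
  have := card_blockFinset_le m'
  gcongr

/-- The contribution of a pair of blocks decays geometrically. -/
theorem exists_block_bound {k : ℕ} (hk : 3 ≤ k) {τ : ℝ} (hτ : 0 < τ)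
    (hτk : k * τ ≤ 1 / (100 * k)) :
    ∃ B : ℕ, ∃ K : ℝ, 0 < K ∧ ∀ m m' : ℕ, 1 ≤ m → m ≤ m' →
      ((2 : ℝ) ^ m) ^ (-1 + k * τ) * ((2 : ℝ) ^ m') ^ (-1 + k * τ) *
      ∑ n ∈ blockFinset m, ∑ n' ∈ blockFinset m', ∑' p : (Fin k → ℤ) × (Fin k → ℤ),
        decayWeight (((2 : ℝ) ^ m) ^ (1 / (k : ℝ) + τ)) (2 + B) p.1 *
        decayWeight (((2 : ℝ) ^ m') ^ (1 / (k : ℝ) + τ)) (2 + B) p.2 *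
        pairWeight n n' p.1 p.2 ≤ K * (1 / ((2 : ℝ) ^ m') ^ (1 / (100 * k : ℝ))) := by
  obtain ⟨K₁, hK₁, hcount⟩ := exists_sum_boundedTuples_le hk
  have hk' : (0 : ℝ) < k := by positivity
  -- With `g = N^τ` this gives `g^B ≥ N^3`, which exceeds `(N L^15)^2`, so both kinds of tail are
  -- covered by one `δ`.
  obtain ⟨B, hB⟩ := exists_nat_ge (3 / τ)
  rw [div_le_iff₀ hτ] at hB
  refine ⟨B, 9 ^ k + K₁, by positivity, fun m m' hm hmm => ?_⟩
  set M : ℝ := 2 ^ m with hM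
  set N : ℝ := 2 ^ m' with hN
  have hM1 : 1 ≤ M := one_le_pow₀ (by norm_num)
  have hN1 : 1 ≤ N := one_le_pow₀ (by norm_num)
  have hM0 : 0 < M := by linarith
  have hN0 : 0 < N := by linarith
  have hMN : M ≤ N := pow_le_pow_right₀ (by norm_num) hmm
  -- With this unit `N^(1/k) = L^100`, and the smallness of `τ` says that every loss `N^(kτ)` is at
  -- most `L`.
  set L : ℝ := N ^ (1 / (100 * k : ℝ)) with hL
  set g : ℝ := N ^ τ with hg
  have hL1 : 1 ≤ L := Real.one_le_rpow hN1 (by positivity)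
  have hg1 : 1 ≤ g := Real.one_le_rpow hN1 hτ.le
  have hLN : L ^ (100 * k) = N := by
    rw [hL, ← Real.rpow_natCast, ← Real.rpow_mul hN0.le]
    push_cast
    rw [one_div_mul_cancel (by positivity), Real.rpow_one]
  have hgkN : g ^ k = N ^ (k * τ) := by
    rw [hg, ← Real.rpow_natCast, ← Real.rpow_mul hN0.le, mul_comm]
  have hNL : N ^ (k * τ) ≤ L := Real.rpow_le_rpow_of_exponent_le hN1 hτk
  have hML : M ^ (k * τ) ≤ L := (Real.rpow_le_rpow hM0.le hMN (by positivity)).trans hNL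
  have hgk : g ^ k ≤ L := hgkN ▸ hNL
  set X : ℝ := M ^ (1 / (k : ℝ) + τ) with hX
  have hX1 : 1 ≤ X := Real.one_le_rpow hM1 (by positivity)
  have hXN : N ^ (1 / (k : ℝ) + τ) = L ^ 100 * g := by
    rw [Real.rpow_add hN0, hL, ← Real.rpow_natCast (N ^ _), ← Real.rpow_mul hN0.le]
    congr 2
    field_simp
    norm_num
  have hXL : X ≤ L ^ 100 * g := hXN ▸ Real.rpow_le_rpow hM0.le hMN (by positivity)
  have hpowk : ∀ R : ℝ, 0 < R → (R ^ (1 / (k : ℝ) + τ)) ^ k = R * R ^ (k * τ) := fun R hR => by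
    rw [← Real.rpow_natCast, ← Real.rpow_mul hR.le, ← Real.rpow_one_add' hR.le (by positivity)]
    congr 1
    field_simp
  have hXk : X ^ k ≤ M * L := by rw [hX, hpowk M hM0]; gcongr
  have hX'1 : 1 ≤ L ^ 100 * g := hX1.trans hXL
  have hX'k : (L ^ 100 * g) ^ k ≤ N * L := by rw [← hXN, hpowk N hN0]; gcongr
  have hG := hcount m m' L g X (hm.trans hmm) hL1 hLN hg1 hgk hX1 hXL hXk
  have hgB : 1 / g ^ B ≤ 1 / (N * L ^ 15) ^ 2 := by
    have h1 : N ^ 3 ≤ g ^ B := by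
      rw [hg, ← Real.rpow_natCast (N ^ τ), ← Real.rpow_mul hN0.le, ← Real.rpow_natCast N]
      exact Real.rpow_le_rpow_of_exponent_le hN1 (by push_cast; linarith)
    have h2 : (N * L ^ 15) ^ 2 ≤ N ^ 3 := by
      have h3 : L ^ 30 ≤ N := hLN ▸ pow_le_pow_right₀ hL1 (by omega)
      calc (N * L ^ 15) ^ 2 = N ^ 2 * L ^ 30 := by ring
        _ ≤ N ^ 2 * N := by gcongr
        _ = N ^ 3 := by ring
    gcongr
    exact h2.trans h1
  have hsum := sum_block_le hX1 hX'1 (by linarith) (by positivity) hgB le_rfl hG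
  rw [hXN]
  have ha : M ^ (-1 + k * τ) ≤ L / M := by
    rw [Real.rpow_add hM0, Real.rpow_neg_one, div_eq_inv_mul]; gcongr
  have hb : N ^ (-1 + k * τ) ≤ L / N := by
    rw [Real.rpow_add hN0, Real.rpow_neg_one, div_eq_inv_mul]; gcongr
  have hW0 : 0 ≤ ∑ n ∈ blockFinset m, ∑ n' ∈ blockFinset m', ∑' p : (Fin k → ℤ) × (Fin k → ℤ),
        decayWeight X (2 + B) p.1 * decayWeight (L ^ 100 * g) (2 + B) p.2 *
        pairWeight n n' p.1 p.2 :=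
    Finset.sum_nonneg fun n _ => Finset.sum_nonneg fun n' _ => tsum_nonneg fun p =>
      mul_nonneg (mul_nonneg (decayWeight_nonneg (by linarith) _ _)
        (decayWeight_nonneg (by linarith) _ _)) (pairWeight_nonneg _ _ _ _)
  refine (mul_le_mul (mul_le_mul ha hb (by positivity) (by positivity)) hsum hW0
    (by positivity)).trans ?_
  -- The coefficients lose `L^2` against `1 / (M N)`, so the saving `L^3` in the count leaves `1 /
  -- L`; the tails are smaller still.
  calc L / M * (L / N) * (M * N * (1 / (N * L ^ 15) ^ 2 *
        ((3 ^ k * X ^ k) * (3 ^ k * (L ^ 100 * g) ^ k))) + K₁ * M * N / L ^ 3)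
      ≤ L / M * (L / N) * (M * N * (1 / (N * L ^ 15) ^ 2 *
        ((3 ^ k * (M * L)) * (3 ^ k * (N * L)))) + K₁ * M * N / L ^ 3) := by gcongr
    _ = 9 ^ k * (M / N) * (1 / L ^ 26) + K₁ * (1 / L) := by
      rw [show (9 : ℝ) ^ k = 3 ^ k * 3 ^ k by rw [← mul_pow]; norm_num]
      field_simp
    _ ≤ 9 ^ k * 1 * (1 / L) + K₁ * (1 / L) := by
      have h1 : M / N ≤ 1 := (div_le_one hN0).2 hMN
      have h2 : L ≤ L ^ 26 := le_self_pow₀ hL1 (by norm_num)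
      gcongr
    _ = _ := by ring

/-! ### Summation over all pairs of blocks -/

theorem pairWeight_comm {k : ℕ} (n n' : ℕ) (t t' : Fin k → ℤ) :
    pairWeight n n' t t' = pairWeight n' n t' t := by
  have : pairFreq n n' t t' = pairFreq n' n t' t := funext fun j => add_comm _ _
  unfold pairWeight
  rw [this]
  congr 1
  exact propext (by tauto)

theorem sum_Icc_sum_Icc_le_blocks {Q : ℕ → ℕ → ℝ} (hQ : ∀ n n', 0 ≤ Q n n') (N : ℕ) :
    ∑ n ∈ Finset.Icc 1 N, ∑ n' ∈ Finset.Icc 1 N, Q n n' ≤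
      ∑ m ∈ Finset.Icc 1 N, ∑ m' ∈ Finset.Icc 1 N,
        ∑ n ∈ blockFinset m, ∑ n' ∈ blockFinset m', Q n n' := by
  have hone : ∀ q : ℕ → ℝ, (∀ n, 0 ≤ q n) → ∑ n ∈ Finset.Icc 1 N, q n ≤
      ∑ m ∈ Finset.Icc 1 N, ∑ n ∈ blockFinset m, q n := fun q hq => by
    have hmaps : ∀ n ∈ Finset.Icc 1 N, n.size ∈ Finset.Icc 1 N := fun n hn => by
      rw [Finset.mem_Icc] at hn ⊢
      exact ⟨Nat.size_pos.2 hn.1, (Nat.size_le.2 Nat.lt_two_pow_self).trans hn.2⟩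
    rw [← Finset.sum_fiberwise_of_maps_to hmaps]
    refine Finset.sum_le_sum fun m _ => Finset.sum_le_sum_of_subset_of_nonneg (fun n hn => ?_)
      fun n _ _ => hq n
    rw [Finset.mem_filter, Finset.mem_Icc] at hn
    have := (mem_dyadicBlock_size hn.1.1).2
    rw [hn.2] at this
    exact mem_blockFinset.2 this
  refine (hone _ fun n => Finset.sum_nonneg fun n' _ => hQ n n').trans ?_
  refine Finset.sum_le_sum fun m _ => ?_
  rw [Finset.sum_comm (s := Finset.Icc 1 N)]
  exact Finset.sum_le_sum fun n _ => hone _ (hQ n)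

theorem sum_geometric_pair_le {ρ : ℝ} (h0 : 0 ≤ ρ) (h1 : ρ < 1) (N : ℕ) :
    ∑ m ∈ Finset.Icc 1 N, ∑ m' ∈ Finset.Icc 1 N, ρ ^ m * ρ ^ m' ≤ (1 - ρ)⁻¹ ^ 2 := by
  rw [← Finset.sum_mul_sum, ← pow_two]
  have : ∑ m ∈ Finset.Icc 1 N, ρ ^ m ≤ (1 - ρ)⁻¹ := by
    rw [← tsum_geometric_of_lt_one h0 h1]
    exact (summable_geometric_of_lt_one h0 h1).sum_le_tsum _ fun _ _ => by positivity
  gcongr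

/-- The off-diagonal correlations are bounded uniformly in `N`. -/
theorem exists_offDiagonal_bound {k : ℕ} (hk : 3 ≤ k) {τ : ℝ} (hτ : 0 < τ)
    (hτk : k * τ ≤ 1 / (100 * k)) {f : ℕ → E k → ℝ} (hf : IsAdmissibleFunctionSystem k τ f) :
    ∃ (c : ℕ → (Fin k → ℤ) → ℂ) (K : ℝ), (∀ n, 0 < n → Summable fun t => ‖c n t‖) ∧
      (∀ n, 0 < n → ∀ x, (f n x : ℂ) = trigSeries n (c n) x) ∧
      ∀ N, ∑ n ∈ Finset.Icc 1 N, ∑ n' ∈ Finset.Icc 1 N,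
        ∑' p : (Fin k → ℤ) × (Fin k → ℤ), ‖c n p.1‖ * ‖c n' p.2‖ * pairWeight n n' p.1 p.2 ≤ K := by
  have hk' : (0 : ℝ) < k := by positivity
  obtain ⟨B, K₁, hK₁, hblock⟩ := exists_block_bound hk hτ hτk
  obtain ⟨K, c, hK, hc⟩ := exists_fourier_expansion (by omega) hf (2 + B)
  -- Half of the available exponent: the decay `ρ^(2 m')` in the larger index is at most `ρ^m ρ^m'`,
  -- which can be summed over both indices.
  set ρ : ℝ := 2 ^ (-(1 / (200 * k : ℝ))) with hρ
  have hρ0 : 0 < ρ := by positivity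
  have hρ1 : ρ < 1 := Real.rpow_lt_one_of_one_lt_of_neg one_lt_two
    (neg_lt_zero.2 (by positivity))
  let Q : ℕ → ℕ → ℝ := fun n n' =>
    ∑' p : (Fin k → ℤ) × (Fin k → ℤ), ‖c n p.1‖ * ‖c n' p.2‖ * pairWeight n n' p.1 p.2
  have hQ : ∀ n n', 0 ≤ Q n n' := fun n n' => tsum_nonneg fun p =>
    mul_nonneg (by positivity) (pairWeight_nonneg _ _ _ _)
  have hQcomm : ∀ n n', Q n n' = Q n' n := fun n n' => by
    simp only [Q]
    rw [← (Equiv.prodComm _ _).tsum_eq]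
    refine tsum_congr fun p => ?_
    simp only [Equiv.prodComm_apply, Prod.fst_swap, Prod.snd_swap]
    rw [pairWeight_comm, mul_comm ‖c n p.2‖]
  have hle : ∀ m m', 1 ≤ m → m ≤ m' → ∑ n ∈ blockFinset m, ∑ n' ∈ blockFinset m', Q n n' ≤
      K ^ 2 * K₁ * (ρ ^ m * ρ ^ m') := fun m m' hm hmm => by
    have hpt : ∀ n ∈ blockFinset m, ∀ n' ∈ blockFinset m', Q n n' ≤
        K ^ 2 * (((2 : ℝ) ^ m) ^ (-1 + k * τ) * ((2 : ℝ) ^ m') ^ (-1 + k * τ)) *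
        ∑' p : (Fin k → ℤ) × (Fin k → ℤ),
        decayWeight (((2 : ℝ) ^ m) ^ (1 / (k : ℝ) + τ)) (2 + B) p.1 *
        decayWeight (((2 : ℝ) ^ m') ^ (1 / (k : ℝ) + τ)) (2 + B) p.2 *
        pairWeight n n' p.1 p.2 := fun n hn n' hn' => by
      obtain ⟨s1, -, d1⟩ := hc m hm n (mem_blockFinset.1 hn)
      obtain ⟨s2, -, d2⟩ := hc m' (hm.trans hmm) n' (mem_blockFinset.1 hn')
      rw [← tsum_mul_left]
      refine Summable.tsum_le_tsum (fun p => ?_) (summable_mul_pairWeight (c := fun t => ‖c n t‖)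
        (c' := fun t => ‖c n' t‖) (fun _ => norm_nonneg _)
        (fun _ => norm_nonneg _) s1 s2) (Summable.mul_left _ (summable_mul_pairWeight
        (c := decayWeight (((2 : ℝ) ^ m) ^ (1 / (k : ℝ) + τ)) (2 + B))
        (c' := decayWeight (((2 : ℝ) ^ m') ^ (1 / (k : ℝ) + τ)) (2 + B))
        (decayWeight_nonneg (by positivity) _) (decayWeight_nonneg (by positivity) _)
        (summable_decayWeight (by positivity) (by omega))
        (summable_decayWeight (by positivity) (by omega))))
      have := pairWeight_nonneg n n' p.1 p.2
      calc _ ≤ (K * ((2 : ℝ) ^ m) ^ (-1 + k * τ) *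
            decayWeight (((2 : ℝ) ^ m) ^ (1 / (k : ℝ) + τ)) (2 + B) p.1) *
            (K * ((2 : ℝ) ^ m') ^ (-1 + k * τ) *
            decayWeight (((2 : ℝ) ^ m') ^ (1 / (k : ℝ) + τ)) (2 + B) p.2) *
            pairWeight n n' p.1 p.2 :=
          mul_le_mul_of_nonneg_right (mul_le_mul (d1 p.1) (d2 p.2) (norm_nonneg _)
            ((norm_nonneg _).trans (d1 p.1))) this
        _ = _ := by ring
    refine (Finset.sum_le_sum fun n hn => Finset.sum_le_sum fun n' hn' => hpt n hn n' hn').trans ?_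
    simp only [← Finset.mul_sum]
    rw [mul_assoc (K ^ 2), mul_assoc (K ^ 2)]
    refine mul_le_mul_of_nonneg_left ((hblock m m' hm hmm).trans ?_) (by positivity)
    refine mul_le_mul_of_nonneg_left ?_ hK₁.le
    have e : 1 / ((2 : ℝ) ^ m') ^ (1 / (100 * k : ℝ)) = ρ ^ m' * ρ ^ m' := by
      rw [hρ, ← Real.rpow_natCast, ← Real.rpow_natCast, ← Real.rpow_mul two_pos.le,
        ← Real.rpow_mul two_pos.le, ← Real.rpow_add two_pos, one_div, ← Real.rpow_neg two_pos.le]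
      congr 1
      field_simp
      ring
    rw [e]
    exact mul_le_mul_of_nonneg_right (pow_le_pow_of_le_one hρ0.le hρ1.le hmm) (by positivity)
  refine ⟨c, K ^ 2 * K₁ * (1 - ρ)⁻¹ ^ 2, fun n hn => ?_, fun n hn => ?_, fun N => ?_⟩
  · obtain ⟨h1, h2⟩ := mem_dyadicBlock_size hn
    exact (hc _ h1 n h2).1
  · obtain ⟨h1, h2⟩ := mem_dyadicBlock_size hn
    exact (hc _ h1 n h2).2.1
  · refine (sum_Icc_sum_Icc_le_blocks hQ N).trans ?_
    refine le_trans ?_ (mul_le_mul_of_nonneg_left (sum_geometric_pair_le hρ0.le hρ1 N)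
      (by positivity))
    simp only [Finset.mul_sum]
    refine Finset.sum_le_sum fun m hm => Finset.sum_le_sum fun m' hm' => ?_
    rcases le_total m m' with h | h
    · exact hle m m' (Finset.mem_Icc.1 hm).1 h
    · rw [Finset.sum_comm, mul_comm (ρ ^ m)]
      refine le_trans (le_of_eq ?_) (hle m' m (Finset.mem_Icc.1 hm').1 h)
      exact Finset.sum_congr rfl fun n' _ => Finset.sum_congr rfl fun n _ => hQcomm n n'

end CurvedVariance
end

theorem mainTheorem8 (k : ℕ) (hk : 3 ≤ k) :
    ∃ τ₀ : ℝ, 0 < τ₀ ∧ ∀ τ : ℝ, 0 < τ → τ ≤ τ₀ →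
      ∀ f : ℕ → CurvedVariance.E k → ℝ, CurvedVariance.IsAdmissibleFunctionSystem k τ f →
      ∀ μ : Measure (CurvedVariance.E k), IsProbabilityMeasure μ →
        μ (CurvedVariance.unitCube k)ᶜ = 0 →
        (∃ C : ℝ, ∀ ξ : CurvedVariance.E k,
          ‖CurvedVariance.fourierTransform μ ξ‖ ≤ C * (1 + ‖ξ‖) ^ (-2 : ℝ)) →
        CurvedVariance.VarianceTransference f μ := by
  have hk' : (0 : ℝ) < k := by positivity
  -- This threshold is exactly `kτ ≤ 1 / (100 k)`, that is, `N^(kτ) ≤ L` in `exists_block_bound`.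
  refine ⟨1 / (100 * k ^ 2), by positivity, fun τ hτ hτ₀ f hf μ hμ _ hdecay => ?_⟩
  obtain ⟨C, hC⟩ := hdecay
  have hτk : k * τ ≤ 1 / (100 * k) := by
    calc k * τ ≤ k * (1 / (100 * (k : ℝ) ^ 2)) := by gcongr
      _ = 1 / (100 * k) := by field_simp
  obtain ⟨c, K, hc, hfc, hK⟩ := CurvedVariance.exists_offDiagonal_bound hk hτ hτk hf
  have hC0 : 0 ≤ C := by simpa using (norm_nonneg _).trans (hC 0)
  -- The whole difference goes into the bounded term, along the full sequence of `N`.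
  refine ⟨id, strictMono_id, 0, fun N => CurvedVariance.variance f μ N -
    CurvedVariance.variance f (CurvedVariance.lebesgueCube k) N, isLittleO_zero _ _, ?_, fun N => ?_⟩
  · refine IsBigO.of_bound (C * K) (Eventually.of_forall fun N => ?_)
    rw [norm_one, mul_one, Real.norm_eq_abs]
    exact (CurvedVariance.abs_variance_sub_le hc hfc μ hC N).trans
      (mul_le_mul_of_nonneg_left (hK N) hC0)
  · simp
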